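/- Let $Y$ and $U$ be separable real Hilbert spaces with their Borel $\sigma$-algebras, let $Y\times U$ carry the Hilbert structure whose inner product is the sum of those of $Y$ and $U$, with distance $d$, let $\mu$ be a Borel probability measure on $Y$, and let $1\le p<\infty$. For a separable Hilbert space $X$, write $\mathcal P_p(X)$ for the Borel probability measures on $X$ with finite $p$-th moment, and $W_p(\eta,\nu)=\big(\inf_\gamma\int \|x_0-x_1\|^p\,d\gamma(x_0,x_1)\big)^{1/p}$, the infimum being over all couplings $\gamma$ of $\eta$ and $\nu$. Let $$\mathcal P_p^\mu(Y\times U)=\{\eta\in\mathcal P_p(Y\times U) : \pi^Y_\#\eta=\mu\},$$ and for $\eta\in\mathcal P_p^\mu(Y\times U)$ let $(\eta^y)_{y\in Y}$ be a disintegration of $\eta$ along $Y$, i.e. a measurable family of Borel probability measures on $U$ with $\eta(dy,du)=\eta^y(du)\,\mu(dy)$. For $\eta,\nu\in\mathcal P_p^\mu(Y\times U)$ define the conditional $p$-Wasserstein distance $$W_p^\mu(\eta,\nu)=\Big(\int_Y W_p(\eta^y,\nu^y)^p\,d\mu(y)\Big)^{1/p}$$ and the set of triangular couplings $$\Pi_Y(\eta,\nu)=\{\gamma\in\mathcal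 P((Y\times U)^2) : \gamma \text{ has marginals } \eta \text{ and } \nu,\ \pi^{1,3}_\#\gamma=(I,I)_\#\mu\},$$ where $\pi^{1,3}(y_0,u_0,y_1,u_1)=(y_0,y_1)$ and $(I,I)(y)=(y,y)$. Then the following hold. (a) For all $\eta,\nu\in\mathcal P_p^\mu(Y\times U)$, $W_p^\mu(\eta,\nu)$ is well-defined and finite: for every choice of disintegrations, $\eta^y,\nu^y\in\mathcal P_p(U)$ and $W_p(\eta^y,\nu^y)<\infty$ for $\mu$-almost every $y$, the function $y\mapsto W_p(\eta^y,\nu^y)^p$ is $\mu$-measurable, and the value of the integral is finite and does not depend on the choice. Moreover $$W_p^\mu(\eta,\nu)^p=\min\Big\{\int_{(Y\times U)^2} d\big((y_0,u_0),(y_1,u_1)\big)^p\,d\gamma : \gamma\in\Pi_Y(\eta,\nu)\Big\},$$ the minimum being attained. (b) $W_p^\mu$ is a metric on $\mathcal P_p^\mu(Y\times U)$. (c) If $U\ne\{0\}$, and if $\mu$ has finite $p$-th moment and is not a Dirac mass, then there is no constant $C$ such that $W_p^\mu(\eta,\nu)\le C\,W_p(\eta,\nu)$ for all $\eta,\nu\in\mathcal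 P_p^\mu(Y\times U)$. (d) For all $\eta,\nu\in\mathcal P_p^\mu(Y\times U)$, $W_p(\pi^U_\#\eta,\pi^U_\#\nu)\le W_p^\mu(\eta,\nu)$ and $W_p(\eta,\nu)\le W_p^\mu(\eta,\nu)$. -/

import Mathlib

open MeasureTheory ProbabilityTheory
open scoped ENNReal NNReal

noncomputable section

namespace CondWasserstein

/-! ### The usual Wasserstein distance -/

/-- The couplings of `η` and `ν`: the measures on `X × X` whose first marginal is `η` and whose
second marginal is `ν`. (If `η` is a probability measure, then so is each coupling.) -/
def couplings {X : Type*} [MeasurableSpace X] (η ν : Measure X) : Set (Measure (X × X)) :=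
  {γ | γ.map Prod.fst = η ∧ γ.map Prod.snd = ν}

/-- The transport cost `∫ d(x, x')^p dγ(x, x')` of a plan `γ`. -/
def cost {X : Type*} [MeasurableSpace X] [PseudoEMetricSpace X] (p : ℝ) (γ : Measure (X × X)) :
    ℝ≥0∞ :=
  ∫⁻ z, edist z.1 z.2 ^ p ∂γ

/-- The `p`-Wasserstein distance `W_p(η, ν)`, with values in `[0, ∞]`. -/
def wasserstein {X : Type*} [MeasurableSpace X] [PseudoEMetricSpace X] (p : ℝ)
    (η ν : Measure X) : ℝ≥0∞ :=
  (⨅ γ ∈ couplings η ν, cost p γ) ^ (1 / p)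

/-- The measure has a finite `p`-th moment. -/
def HasFiniteMoment {X : Type*} [MeasurableSpace X] [NormedAddCommGroup X] (p : ℝ)
    (η : Measure X) : Prop :=
  ∫⁻ x, ‖x‖ₑ ^ p ∂η < ∞

/-! ### The conditional Wasserstein space

The Hilbert space `Y × U`, with inner product the sum of those of `Y` and `U`, is
`WithLp 2 (Y × U)`. -/

section Joint

variable {Y U : Type*}
  [NormedAddCommGroup Y] [InnerProductSpace ℝ Y] [CompleteSpace Y] [SecondCountableTopology Y]
  [MeasurableSpace Y] [BorelSpace Y]
  [NormedAddCommGroup U] [InnerProductSpace ℝ U] [CompleteSpace U] [SecondCountableTopology U]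
  [MeasurableSpace U] [BorelSpace U]

/-- The `Y`-marginal of a joint measure. -/
def marginalY (η : Measure (WithLp 2 (Y × U))) : Measure Y := η.map WithLp.fst

/-- The `U`-marginal of a joint measure. -/
def marginalU (η : Measure (WithLp 2 (Y × U))) : Measure U := η.map WithLp.snd

/-- The conditional Wasserstein space `P_p^μ(Y × U)`: the Borel probability measures on `Y × U`
with finite `p`-th moment and `Y`-marginal `μ`. -/
def space (U : Type*) [NormedAddCommGroup U] [InnerProductSpace ℝ U] [MeasurableSpace U]
    (p : ℝ) (μ : Measure Y) : Set (ProbabilityMeasure (WithLp 2 (Y × U))) :=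
  {η | HasFiniteMoment p (η : Measure (WithLp 2 (Y × U))) ∧
    marginalY (η : Measure (WithLp 2 (Y × U))) = μ}

/-- `κ` is a disintegration `(η^y)` of `η` along `Y`: a measurable family of probability measures
on `U` such that `η(dy, du) = κ y (du) η_Y(dy)`, where `η_Y` is the `Y`-marginal. -/
def IsDisintegration (κ : Kernel Y U) (η : Measure (WithLp 2 (Y × U))) : Prop :=
  IsMarkovKernel κ ∧ (marginalY η).compProd κ = η.map WithLp.ofLp

/-- A choice `y ↦ η^y` of the conditional measures of `η`. -/
def conditional (η : Measure (WithLp 2 (Y × U))) [IsFiniteMeasure η] : Kernel Y U :=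
  (η.map WithLp.ofLp).condKernel

/-- The chosen conditional measures form a disintegration. -/
theorem isDisintegration_conditional (η : Measure (WithLp 2 (Y × U))) [IsFiniteMeasure η] :
    IsDisintegration (conditional η) η := by
  refine ⟨by unfold conditional; infer_instance, ?_⟩
  have h : marginalY η = (η.map (WithLp.ofLp : WithLp 2 (Y × U) → Y × U)).fst := by
    rw [Measure.fst, Measure.map_map measurable_fst (WithLp.measurable_ofLp 2 (Y × U))]
    rfl
  rw [h, conditional]
  exact Measure.disintegrate _ (η.map (WithLp.ofLp : WithLp 2 (Y × U) → Y × U)).condKernel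

/-- The value `(∫ W_p(κ y, κ' y)^p dμ(y))^{1/p}` for two families of measures on `U`. -/
def meanWasserstein (p : ℝ) (μ : Measure Y) (κ κ' : Kernel Y U) : ℝ≥0∞ :=
  (∫⁻ y, wasserstein p (κ y) (κ' y) ^ p ∂μ) ^ (1 / p)

/-- The conditional `p`-Wasserstein distance
`W_p^μ(η, ν) = (∫ W_p(η^y, ν^y)^p dμ(y))^{1/p}`. -/
def condWasserstein (p : ℝ) (μ : Measure Y) (η ν : ProbabilityMeasure (WithLp 2 (Y × U))) :
    ℝ≥0∞ :=
  meanWasserstein p μ (conditional (η : Measure (WithLp 2 (Y × U))))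
    (conditional (ν : Measure (WithLp 2 (Y × U))))

/-- The triangular couplings `Π_Y(η, ν)`: the couplings of `η` and `ν` whose marginal in
`(y₀, y₁)` is the image of `μ` under `y ↦ (y, y)`. -/
def triangularCouplings (μ : Measure Y) (η ν : Measure (WithLp 2 (Y × U))) :
    Set (Measure (WithLp 2 (Y × U) × WithLp 2 (Y × U))) :=
  {γ | γ ∈ couplings η ν ∧ γ.map (fun z => (z.1.fst, z.2.fst)) = μ.map (fun y => (y, y))}

end Joint

end CondWasserstein

end

/-!
Disintegrating a triangular coupling along the common `Y`-coordinate gives couplings of the fibres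
`η^y` and `ν^y`, so its cost is at least `∫ W_p(η^y, ν^y)^p dμ` (`lintegral_wasserstein_le_cost`).
For the converse one needs couplings of the fibres that are nearly optimal and depend measurably
on `y`. They are obtained without a measurable selection theorem. Cut `U` into countably many small
cells. A density `g` on `U × U` that is constant on products of cells, has rational values and is
nonzero on finitely many of them defines a subcoupling `g • (η^y ⊗ ν^y)` for a measurable set of
`y`, and adding the normalized product of the residual marginals turns it into a coupling. There
are countably many such `g`, each gives a kernel of couplings (`completionKernel`), and their
costs have infimum `W_p(η^y, ν^y)^p` for every `y` with finite moments: round down the cell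
densities of any coupling, and note that the residual mass has vanishing `p`-th moment
(`exists_couplingKernel_seq`). Hence `y ↦ W_p(η^y, ν^y)^p` is measurable, and taking the first
kernel that is nearly optimal at `y` gives a measurable choice (`exists_couplingKernel_cost_le`).
The minimum over triangular couplings is attained by Prokhorov's theorem, since the cost is weakly
lower semicontinuous and the triangularity constraint weakly closed
(`exists_triangular_minimizer`).

The triangle inequality holds on the fibres by gluing couplings and is integrated with Minkowski's
inequality. Definiteness and the comparison with `W_p` follow from the attained minimum.

To see that `W_p` does not dominate, take a set `A` with `0 < μ A < 1` and raise the mass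
`μ A * μ Aᶜ` to height `v`, spread once over `A` and once over `Aᶜ`. Moving this mass between `A`
and `Aᶜ` at constant height, and the same amount back at height `0`, costs a finite amount that
does not depend on `v`, whereas a triangular coupling has to lower it by `‖v‖`, which is
arbitrarily large (`not_exists_condWasserstein_le`).
-/

noncomputable section

namespace CondWasserstein

open Filter Topology

/-! ### Couplings and the Wasserstein distance -/

section Generic

variable {X : Type*} [MeasurableSpace X]

lemma prod_mem_couplings (η ν : Measure X) [IsProbabilityMeasure η] [IsProbabilityMeasure ν] :
    η.prod ν ∈ couplings η ν := by
  refine ⟨?_, ?_⟩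
  · simp
  · simp

lemma swap_mem_couplings {η ν : Measure X} {γ : Measure (X × X)} (h : γ ∈ couplings η ν) :
    γ.map Prod.swap ∈ couplings ν η := by
  refine ⟨?_, ?_⟩
  · rw [Measure.map_map measurable_fst measurable_swap]; exact h.2
  · rw [Measure.map_map measurable_snd measurable_swap]; exact h.1

lemma isProbabilityMeasure_of_mem_couplings {η ν : Measure X} [IsProbabilityMeasure η]
    {γ : Measure (X × X)} (h : γ ∈ couplings η ν) : IsProbabilityMeasure γ := by
  have : IsProbabilityMeasure (γ.map Prod.fst) := by rw [h.1]; infer_instance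
  exact Measure.isProbabilityMeasure_of_map (Prod.fst : X × X → X)

lemma diag_mem_couplings (η : Measure X) : η.map (fun x => (x, x)) ∈ couplings η η := by
  have hd : Measurable fun x : X => (x, x) := by fun_prop
  refine ⟨?_, ?_⟩
  · rw [Measure.map_map measurable_fst hd]; exact Measure.map_id
  · rw [Measure.map_map measurable_snd hd]; exact Measure.map_id

/-- Couplings push forward to couplings. -/
lemma map_mem_couplings {Z : Type*} [MeasurableSpace Z] {f : X → Z} (hf : Measurable f)
    {η ν : Measure X} {γ : Measure (X × X)} (h : γ ∈ couplings η ν) :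
    γ.map (fun z => (f z.1, f z.2)) ∈ couplings (η.map f) (ν.map f) := by
  have hd : Measurable fun z : X × X => (f z.1, f z.2) := by fun_prop
  refine ⟨?_, ?_⟩
  · rw [Measure.map_map measurable_fst hd, ← h.1, Measure.map_map hf measurable_fst]; rfl
  · rw [Measure.map_map measurable_snd hd, ← h.2, Measure.map_map hf measurable_snd]; rfl

variable [PseudoEMetricSpace X]

lemma wasserstein_rpow {p : ℝ} (hp : 0 < p) (η ν : Measure X) :
    wasserstein p η ν ^ p = ⨅ γ ∈ couplings η ν, cost p γ := by
  rw [wasserstein, ← ENNReal.rpow_mul, one_div_mul_cancel hp.ne', ENNReal.rpow_one]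

lemma wasserstein_le_rpow_cost {p : ℝ} (hp : 0 < p) {η ν : Measure X} {γ : Measure (X × X)}
    (h : γ ∈ couplings η ν) : wasserstein p η ν ≤ cost p γ ^ (1 / p) :=
  ENNReal.rpow_le_rpow (iInf₂_le γ h) (by positivity)

lemma wasserstein_rpow_le_cost {p : ℝ} (hp : 0 < p) {η ν : Measure X} {γ : Measure (X × X)}
    (h : γ ∈ couplings η ν) : wasserstein p η ν ^ p ≤ cost p γ := by
  rw [wasserstein_rpow hp]; exact iInf₂_le γ h

/-- A strict upper bound for the distance is witnessed by a coupling. -/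
lemma exists_cost_lt {p : ℝ} (hp : 0 < p) {η ν : Measure X} {r : ℝ≥0∞}
    (h : wasserstein p η ν < r) : ∃ γ ∈ couplings η ν, cost p γ ^ (1 / p) < r := by
  have h' := ENNReal.rpow_lt_rpow h hp
  rw [wasserstein_rpow hp] at h'
  simp only [iInf_lt_iff, exists_prop] at h'
  obtain ⟨γ, hγ, hlt⟩ := h'
  refine ⟨γ, hγ, ?_⟩
  rwa [one_div, ENNReal.rpow_inv_lt_iff hp]

section Measurable

variable [OpensMeasurableSpace X] [SecondCountableTopology X]

lemma measurable_edist_rpow (p : ℝ) : Measurable fun z : X × X => edist z.1 z.2 ^ p := by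
  fun_prop

lemma cost_map_swap (p : ℝ) (γ : Measure (X × X)) : cost p (γ.map Prod.swap) = cost p γ := by
  rw [cost, lintegral_map (measurable_edist_rpow p) measurable_swap]
  simp [cost, edist_comm]

lemma wasserstein_comm (p : ℝ) (η ν : Measure X) : wasserstein p η ν = wasserstein p ν η := by
  unfold wasserstein
  congr 1
  apply le_antisymm
  all_goals
    refine le_iInf₂ fun γ hγ => ?_
    rw [← cost_map_swap]
    exact iInf₂_le _ (swap_mem_couplings hγ)

lemma wasserstein_self {p : ℝ} (hp : 0 < p) (η : Measure X) : wasserstein p η η = 0 := by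
  refine le_antisymm ((wasserstein_le_rpow_cost hp (diag_mem_couplings η)).trans ?_) zero_le
  rw [cost, lintegral_map (measurable_edist_rpow p) (by fun_prop)]
  simp [hp]

lemma eq_of_cost_eq_zero [T0Space X] {p : ℝ} (hp : 0 < p) {η ν : Measure X}
    {γ : Measure (X × X)} (h : γ ∈ couplings η ν) (h0 : cost p γ = 0) : η = ν := by
  rw [cost, lintegral_eq_zero_iff (measurable_edist_rpow p)] at h0
  rw [← h.1, ← h.2]
  refine Measure.map_congr ?_
  filter_upwards [h0] with z hz
  have : edist z.1 z.2 = 0 := by simpa [hp, hp.le, hp.not_gt] using hz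
  exact (EMetric.inseparable_iff.2 this).eq

/-- Gluing: two couplings with a common marginal compose, by disintegrating the second one along
the common marginal, and the costs satisfy Minkowski's inequality. -/
lemma exists_coupling_cost_le_add [StandardBorelSpace X] {p : ℝ} (hp : 1 ≤ p)
    {α β δ : Measure X} [IsProbabilityMeasure α] [IsProbabilityMeasure β]
    {γ₁ γ₂ : Measure (X × X)} (h₁ : γ₁ ∈ couplings α β) (h₂ : γ₂ ∈ couplings β δ) :
    ∃ γ ∈ couplings α δ, cost p γ ^ (1 / p) ≤ cost p γ₁ ^ (1 / p) + cost p γ₂ ^ (1 / p) := by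
  have := isProbabilityMeasure_of_mem_couplings h₁
  have := isProbabilityMeasure_of_mem_couplings h₂
  have : Nonempty X := α.nonempty_of_neZero
  -- the law of `(x₀, x₁, x₂)`, with `x₂` drawn given `x₁`
  set Γ : Measure ((X × X) × X) :=
    γ₁.compProd (γ₂.condKernel.comap Prod.snd measurable_snd) with hΓ
  have e1 : Γ.map Prod.fst = γ₁ := Measure.fst_compProd _ _
  have e2 : Γ.map (fun z => (z.1.2, z.2)) = γ₂ := by
    conv_rhs => rw [← Measure.disintegrate γ₂ γ₂.condKernel]
    have hfst : γ₂.fst = γ₁.map Prod.snd := by rw [h₁.2]; exact h₂.1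
    ext s hs
    rw [Measure.map_apply (by fun_prop) hs, hΓ,
      Measure.compProd_apply ((by fun_prop : Measurable fun z : (X × X) × X => (z.1.2, z.2)) hs),
      Measure.compProd_apply hs, hfst,
      lintegral_map (Kernel.measurable_kernel_prodMk_left hs) measurable_snd]
    rfl
  have m02 : Measurable fun z : (X × X) × X => (z.1.1, z.2) := by fun_prop
  have m12 : Measurable fun z : (X × X) × X => (z.1.2, z.2) := by fun_prop
  refine ⟨Γ.map (fun z => (z.1.1, z.2)), ⟨?_, ?_⟩, ?_⟩
  · rw [Measure.map_map measurable_fst m02, ← h₁.1, ← e1,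
      Measure.map_map measurable_fst measurable_fst]; rfl
  · rw [Measure.map_map measurable_snd m02, ← h₂.2, ← e2,
      Measure.map_map measurable_snd m12]; rfl
  · have c1 : cost p γ₁ = ∫⁻ z, edist z.1.1 z.1.2 ^ p ∂Γ := by
      rw [← e1, cost, lintegral_map (measurable_edist_rpow p) measurable_fst]
    have c2 : cost p γ₂ = ∫⁻ z, edist z.1.2 z.2 ^ p ∂Γ := by
      rw [← e2, cost, lintegral_map (measurable_edist_rpow p) m12]
    rw [c1, c2, cost, lintegral_map (measurable_edist_rpow p) m02]
    refine le_trans ?_ (ENNReal.lintegral_Lp_add_le (f := fun z : (X × X) × X => edist z.1.1 z.1.2)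
      (g := fun z => edist z.1.2 z.2) (by fun_prop) (by fun_prop) hp)
    refine ENNReal.rpow_le_rpow (lintegral_mono fun z => ?_) (by positivity)
    exact ENNReal.rpow_le_rpow (edist_triangle _ _ _) (by positivity)

lemma wasserstein_triangle [StandardBorelSpace X] {p : ℝ} (hp : 1 ≤ p) (α β δ : Measure X)
    [IsProbabilityMeasure α] [IsProbabilityMeasure β] :
    wasserstein p α δ ≤ wasserstein p α β + wasserstein p β δ := by
  have hp0 : 0 < p := by linarith
  refine ENNReal.le_of_forall_pos_le_add fun ε hε hlt => ?_
  have hε' : ((ε : ℝ≥0∞) / 2) ≠ 0 := by simp [hε.ne']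
  have f1 : wasserstein p α β ≠ ∞ := ne_top_of_le_ne_top hlt.ne le_self_add
  have f2 : wasserstein p β δ ≠ ∞ := ne_top_of_le_ne_top hlt.ne le_add_self
  obtain ⟨γ₁, h₁, l₁⟩ := exists_cost_lt hp0 (ENNReal.lt_add_right f1 hε')
  obtain ⟨γ₂, h₂, l₂⟩ := exists_cost_lt hp0 (ENNReal.lt_add_right f2 hε')
  obtain ⟨γ, h, l⟩ := exists_coupling_cost_le_add hp h₁ h₂
  calc wasserstein p α δ ≤ cost p γ ^ (1 / p) := wasserstein_le_rpow_cost hp0 h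
    _ ≤ cost p γ₁ ^ (1 / p) + cost p γ₂ ^ (1 / p) := l
    _ ≤ (wasserstein p α β + ε / 2) + (wasserstein p β δ + ε / 2) := add_le_add l₁.le l₂.le
    _ = wasserstein p α β + wasserstein p β δ + ε := by
      rw [add_add_add_comm, ENNReal.add_halves]

end Measurable

end Generic

lemma edist_rpow_le {X : Type*} [NormedAddCommGroup X] {p : ℝ} (hp : 1 ≤ p) (x y : X) :
    edist x y ^ p ≤ 2 ^ (p - 1) * (‖x‖ₑ ^ p + ‖y‖ₑ ^ p) := by
  refine le_trans (ENNReal.rpow_le_rpow ?_ (by linarith))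
    (ENNReal.rpow_add_le_mul_rpow_add_rpow _ _ hp)
  rw [edist_eq_enorm_sub]; exact enorm_sub_le

lemma cost_le_moments {X : Type*} [NormedAddCommGroup X] [MeasurableSpace X] [BorelSpace X]
    [SecondCountableTopology X] {p : ℝ} (hp : 1 ≤ p) {η ν : Measure X}
    {γ : Measure (X × X)} (h : γ ∈ couplings η ν) :
    cost p γ ≤ 2 ^ (p - 1) * (∫⁻ x, ‖x‖ₑ ^ p ∂η + ∫⁻ x, ‖x‖ₑ ^ p ∂ν) := by
  rw [← h.1, ← h.2, lintegral_map (by fun_prop) measurable_fst,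
    lintegral_map (by fun_prop) measurable_snd, ← lintegral_add_left (by fun_prop),
    ← lintegral_const_mul _ (by fun_prop)]
  exact lintegral_mono fun z => edist_rpow_le hp _ _

lemma two_rpow_ne_top (p : ℝ) (hp : 1 ≤ p) : (2 : ℝ≥0∞) ^ (p - 1) ≠ ∞ :=
  ENNReal.rpow_ne_top_of_nonneg (by linarith) (by simp)

lemma wasserstein_lt_top {X : Type*} [NormedAddCommGroup X] [MeasurableSpace X] [BorelSpace X]
    [SecondCountableTopology X] {p : ℝ} (hp : 1 ≤ p) {η ν : Measure X} [IsProbabilityMeasure η]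
    [IsProbabilityMeasure ν] (hη : HasFiniteMoment p η) (hν : HasFiniteMoment p ν) :
    wasserstein p η ν < ∞ := by
  refine (wasserstein_le_rpow_cost (by linarith) (prod_mem_couplings η ν)).trans_lt ?_
  refine ENNReal.rpow_lt_top_of_nonneg (by positivity) (ne_top_of_le_ne_top ?_
    (cost_le_moments hp (prod_mem_couplings η ν)))
  exact ENNReal.mul_ne_top (two_rpow_ne_top p hp) (ENNReal.add_ne_top.2 ⟨hη.ne, hν.ne⟩)

/-! ### Completing a subcoupling to a coupling -/

section Completion

variable {X : Type*} [MeasurableSpace X]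

/-- The density with respect to `α` of the mass that the first marginal of `g • (α ⊗ β)` lacks.
The subtraction is truncated. -/
def residualLeft (g : X × X → ℝ≥0∞) (β : Measure X) (x : X) : ℝ≥0∞ :=
  1 - ∫⁻ x', g (x, x') ∂β

/-- The density with respect to `β` of the mass that the second marginal of `g • (α ⊗ β)` lacks.
The subtraction is truncated. -/
def residualRight (g : X × X → ℝ≥0∞) (α : Measure X) (x' : X) : ℝ≥0∞ :=
  1 - ∫⁻ x, g (x, x') ∂α

/-- The density `g` plus that of the normalized product of the residual marginals. If no mass is
missing, the second summand is `0 / 0 = 0` almost everywhere. -/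
def completion (g : X × X → ℝ≥0∞) (α β : Measure X) (z : X × X) : ℝ≥0∞ :=
  g z + residualLeft g β z.1 * residualRight g α z.2 / ∫⁻ x, residualLeft g β x ∂α

/-- The marginals of `g • (α ⊗ β)` are at most `α` and `β`. The condition is phrased through
integrals of truncated differences, which depend measurably on `α` and `β`. -/
def IsSubcoupling (g : X × X → ℝ≥0∞) (α β : Measure X) : Prop :=
  ∫⁻ x, ((∫⁻ x', g (x, x') ∂β) - 1) ∂α = 0 ∧ ∫⁻ x', ((∫⁻ x, g (x, x') ∂α) - 1) ∂β = 0

variable {g : X × X → ℝ≥0∞} {α β : Measure X}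

lemma measurable_residualLeft (hg : Measurable g) [SFinite β] :
    Measurable (residualLeft g β) :=
  measurable_const.sub hg.lintegral_prod_right'

lemma measurable_residualRight (hg : Measurable g) [SFinite α] :
    Measurable (residualRight g α) :=
  measurable_const.sub hg.lintegral_prod_left'

lemma measurable_completion (hg : Measurable g) [SFinite α] [SFinite β] :
    Measurable (completion g α β) := by
  have h1 := measurable_residualLeft (β := β) hg
  have h2 := measurable_residualRight (α := α) hg
  unfold completion
  fun_prop

lemma IsSubcoupling.ae_add_residualLeft [SFinite β] (hg : Measurable g) (h : IsSubcoupling g α β) :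
    ∀ᵐ x ∂α, ∫⁻ x', g (x, x') ∂β + residualLeft g β x = 1 := by
  have h1 := h.1
  rw [lintegral_eq_zero_iff (by have := hg.lintegral_prod_right' (ν := β); fun_prop)] at h1
  filter_upwards [h1] with x hx
  exact add_tsub_cancel_of_le (tsub_eq_zero_iff_le.1 hx)

lemma IsSubcoupling.ae_add_residualRight [SFinite α] (hg : Measurable g) (h : IsSubcoupling g α β) :
    ∀ᵐ x' ∂β, ∫⁻ x, g (x, x') ∂α + residualRight g α x' = 1 := by
  have h1 := h.2
  rw [lintegral_eq_zero_iff (by have := hg.lintegral_prod_left' (μ := α); fun_prop)] at h1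
  filter_upwards [h1] with x hx
  exact add_tsub_cancel_of_le (tsub_eq_zero_iff_le.1 hx)

variable [IsProbabilityMeasure α]

lemma lintegral_residualLeft_le_one : ∫⁻ x, residualLeft g β x ∂α ≤ 1 := by
  calc ∫⁻ x, residualLeft g β x ∂α ≤ ∫⁻ _, 1 ∂α := lintegral_mono fun x => tsub_le_self
    _ = 1 := by simp

variable [IsProbabilityMeasure β]

namespace IsSubcoupling

/-- Both residual marginals have the same mass. -/
lemma lintegral_residual_eq (hg : Measurable g) (h : IsSubcoupling g α β) :
    ∫⁻ x, residualLeft g β x ∂α = ∫⁻ x', residualRight g α x' ∂β := by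
  have e1 : ∫⁻ x, ∫⁻ x', g (x, x') ∂β ∂α + ∫⁻ x, residualLeft g β x ∂α = 1 := by
    rw [← lintegral_add_left hg.lintegral_prod_right',
      lintegral_congr_ae (h.ae_add_residualLeft hg)]
    simp
  have e2 : ∫⁻ x, ∫⁻ x', g (x, x') ∂β ∂α + ∫⁻ x', residualRight g α x' ∂β = 1 := by
    rw [lintegral_lintegral_swap (f := fun x x' => g (x, x')) hg.aemeasurable, ← lintegral_add_left hg.lintegral_prod_left',
      lintegral_congr_ae (h.ae_add_residualRight hg)]
    simp
  have hfin : ∫⁻ x, ∫⁻ x', g (x, x') ∂β ∂α ≠ ∞ :=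
    ne_top_of_le_ne_top ENNReal.one_ne_top (le_self_add.trans_eq e1)
  exact (ENNReal.add_right_inj hfin).1 (e1.trans e2.symm)

lemma ae_lintegral_completion_left (hg : Measurable g) (h : IsSubcoupling g α β) :
    ∀ᵐ x ∂α, ∫⁻ x', completion g α β (x, x') ∂β = 1 := by
  have hc := h.lintegral_residual_eq hg
  have hc1 := lintegral_residualLeft_le_one (g := g) (α := α) (β := β)
  have hz : ∀ᵐ x ∂α, ∫⁻ x, residualLeft g β x ∂α = 0 → residualLeft g β x = 0 := by
    by_cases h0 : ∫⁻ x, residualLeft g β x ∂α = 0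
    · have h0' := h0
      rw [lintegral_eq_zero_iff (measurable_residualLeft hg)] at h0'
      filter_upwards [h0'] with x hx _ using hx
    · exact Eventually.of_forall fun x hx => absurd hx h0
  filter_upwards [h.ae_add_residualLeft hg, hz] with x hx hx0
  have hR := measurable_residualRight (α := α) hg
  unfold completion
  rw [lintegral_add_left (by fun_prop)]
  simp only [div_eq_mul_inv, mul_assoc]
  rw [lintegral_const_mul _ (by fun_prop), lintegral_mul_const _ (by fun_prop), ← hc]
  by_cases h0 : ∫⁻ x, residualLeft g β x ∂α = 0
  · simpa [hx0 h0] using hx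
  · rw [ENNReal.mul_inv_cancel h0 (ne_top_of_le_ne_top ENNReal.one_ne_top hc1), mul_one, hx]

lemma ae_lintegral_completion_right (hg : Measurable g) (h : IsSubcoupling g α β) :
    ∀ᵐ x' ∂β, ∫⁻ x, completion g α β (x, x') ∂α = 1 := by
  have hc := h.lintegral_residual_eq hg
  have hc1 := lintegral_residualLeft_le_one (g := g) (α := α) (β := β)
  have hz : ∀ᵐ x ∂β, ∫⁻ x, residualRight g α x ∂β = 0 → residualRight g α x = 0 := by
    by_cases h0 : ∫⁻ x, residualRight g α x ∂β = 0
    · have h0' := h0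
      rw [lintegral_eq_zero_iff (measurable_residualRight hg)] at h0'
      filter_upwards [h0'] with x hx _ using hx
    · exact Eventually.of_forall fun x hx => absurd hx h0
  filter_upwards [h.ae_add_residualRight hg, hz] with x hx hx0
  have hL := measurable_residualLeft (β := β) hg
  unfold completion
  rw [lintegral_add_left (by fun_prop)]
  simp only [div_eq_mul_inv, mul_assoc]
  rw [lintegral_mul_const _ hL]
  rw [← hc] at hx0
  by_cases h0 : ∫⁻ x, residualLeft g β x ∂α = 0
  · simpa [hx0 h0] using hx
  · rw [mul_left_comm, ENNReal.mul_inv_cancel h0 (ne_top_of_le_ne_top ENNReal.one_ne_top hc1),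
      mul_one, hx]

lemma withDensity_completion_mem_couplings (hg : Measurable g) (h : IsSubcoupling g α β) :
    (α.prod β).withDensity (completion g α β) ∈ couplings α β := by
  have hm := measurable_completion (α := α) (β := β) hg
  refine ⟨?_, ?_⟩
  · ext s hs
    rw [Measure.map_apply measurable_fst hs, withDensity_apply _ (measurable_fst hs),
      ← lintegral_indicator (measurable_fst hs),
      lintegral_prod _ (hm.indicator (measurable_fst hs)).aemeasurable]
    have : ∀ x, ∫⁻ x', (Prod.fst ⁻¹' s).indicator (completion g α β) (x, x') ∂β
        = s.indicator (fun x => ∫⁻ x', completion g α β (x, x') ∂β) x := by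
      intro x
      by_cases hx : x ∈ s <;> simp [Set.indicator, hx]
    simp_rw [this]
    rw [lintegral_indicator hs,
      setLIntegral_congr_fun_ae hs ((h.ae_lintegral_completion_left hg).mono fun x hx _ => hx)]
    simp
  · ext s hs
    rw [Measure.map_apply measurable_snd hs, withDensity_apply _ (measurable_snd hs),
      ← lintegral_indicator (measurable_snd hs),
      lintegral_prod_symm _ (hm.indicator (measurable_snd hs)).aemeasurable]
    have : ∀ x', ∫⁻ x, (Prod.snd ⁻¹' s).indicator (completion g α β) (x, x') ∂α
        = s.indicator (fun x' => ∫⁻ x, completion g α β (x, x') ∂α) x' := by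
      intro x
      by_cases hx : x ∈ s <;> simp [Set.indicator, hx]
    simp_rw [this]
    rw [lintegral_indicator hs,
      setLIntegral_congr_fun_ae hs ((h.ae_lintegral_completion_right hg).mono fun x hx _ => hx)]
    simp

end IsSubcoupling

/-- The product of the residual marginals costs no more than their moments. -/
lemma IsSubcoupling.cost_completion_le {U : Type*} [NormedAddCommGroup U] [MeasurableSpace U]
    [BorelSpace U] [SecondCountableTopology U] {p : ℝ} (hp : 1 ≤ p) {g : U × U → ℝ≥0∞}
    (hg : Measurable g) {α β : Measure U} [IsProbabilityMeasure α] [IsProbabilityMeasure β]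
    (h : IsSubcoupling g α β) :
    cost p ((α.prod β).withDensity (completion g α β)) ≤
      ∫⁻ z, g z * edist z.1 z.2 ^ p ∂(α.prod β) +
        2 ^ (p - 1) * (∫⁻ x, ‖x‖ₑ ^ p * residualLeft g β x ∂α +
          ∫⁻ x, ‖x‖ₑ ^ p * residualRight g α x ∂β) := by
  have hL := measurable_residualLeft (β := β) hg
  have hR := measurable_residualRight (α := α) hg
  have hc := h.lintegral_residual_eq hg
  set c := ∫⁻ x, residualLeft g β x ∂α with hcdef
  rw [cost, lintegral_withDensity_eq_lintegral_mul _ (measurable_completion hg)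
    (measurable_edist_rpow p)]
  have hle : ∀ z : U × U, (completion g α β * fun z : U × U => edist z.1 z.2 ^ p) z ≤
      g z * edist z.1 z.2 ^ p + 2 ^ (p - 1) *
        (((‖z.1‖ₑ ^ p * residualLeft g β z.1) * residualRight g α z.2) * c⁻¹ +
          (residualLeft g β z.1 * (‖z.2‖ₑ ^ p * residualRight g α z.2)) * c⁻¹) := by
    intro z
    simp only [Pi.mul_apply, completion, ← hcdef, add_mul]
    refine add_le_add le_rfl ?_
    calc _ ≤ residualLeft g β z.1 * residualRight g α z.2 / c *
          (2 ^ (p - 1) * (‖z.1‖ₑ ^ p + ‖z.2‖ₑ ^ p)) := by gcongr; exact edist_rpow_le hp _ _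
      _ = _ := by rw [div_eq_mul_inv]; ring
  refine (lintegral_mono hle).trans ?_
  rw [lintegral_add_left (by fun_prop), lintegral_const_mul _ (by fun_prop),
    lintegral_add_left (by fun_prop), lintegral_mul_const _ (by fun_prop),
    lintegral_mul_const _ (by fun_prop),
    lintegral_prod_mul (f := fun x => ‖x‖ₑ ^ p * residualLeft g β x) (by fun_prop) (by fun_prop),
    lintegral_prod_mul (g := fun x => ‖x‖ₑ ^ p * residualRight g α x) (by fun_prop) (by fun_prop),
    ← hc, ← hcdef]
  gcongr
  · rw [mul_assoc, ← div_eq_mul_inv]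
    exact mul_le_of_le_one_right' ENNReal.div_self_le_one
  · rw [mul_right_comm, ← div_eq_mul_inv]
    exact mul_le_of_le_one_left' ENNReal.div_self_le_one

end Completion

section Kernel

variable {Y U : Type*} [MeasurableSpace Y] [MeasurableSpace U]

open Classical in
/-- A coupling kernel built from a density `g`: complete `g` where it is a subcoupling, and take
the product coupling elsewhere. -/
def completionKernel (g : U × U → ℝ≥0∞) (κ κ' : Kernel Y U) : Kernel Y (U × U) :=
  Kernel.withDensity (κ ×ₖ κ')
    (fun y z => if IsSubcoupling g (κ y) (κ' y) then completion g (κ y) (κ' y) z else 1)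

variable {g : U × U → ℝ≥0∞} (κ κ' : Kernel Y U) [IsMarkovKernel κ] [IsMarkovKernel κ']

lemma measurableSet_isSubcoupling (hg : Measurable g) :
    MeasurableSet {y | IsSubcoupling g (κ y) (κ' y)} := by
  have m1 : Measurable fun q : Y × U => ∫⁻ x', g (q.2, x') ∂(κ' q.1) :=
    Measurable.lintegral_kernel_prod_right' (κ := κ'.comap Prod.fst measurable_fst)
      (f := fun q : (Y × U) × U => g (q.1.2, q.2)) (by fun_prop)
  have m2 : Measurable fun q : Y × U => ∫⁻ x, g (x, q.2) ∂(κ q.1) :=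
    Measurable.lintegral_kernel_prod_right' (κ := κ.comap Prod.fst measurable_fst)
      (f := fun q : (Y × U) × U => g (q.2, q.1.2)) (by fun_prop)
  refine MeasurableSet.inter ?_ ?_
  · exact (Measurable.lintegral_kernel_prod_right' (κ := κ)
      (f := fun q : Y × U => (∫⁻ x', g (q.2, x') ∂(κ' q.1)) - 1)
      (by fun_prop)) (measurableSet_singleton 0)
  · exact (Measurable.lintegral_kernel_prod_right' (κ := κ')
      (f := fun q : Y × U => (∫⁻ x, g (x, q.2) ∂(κ q.1)) - 1)
      (by fun_prop)) (measurableSet_singleton 0)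

lemma measurable_completion_kernel (hg : Measurable g) :
    Measurable fun q : Y × (U × U) => completion g (κ q.1) (κ' q.1) q.2 := by
  have m1 : Measurable fun q : Y × U => residualLeft g (κ' q.1) q.2 := by
    have : Measurable fun q : Y × U => ∫⁻ x', g (q.2, x') ∂(κ' q.1) :=
      Measurable.lintegral_kernel_prod_right' (κ := κ'.comap Prod.fst measurable_fst)
        (f := fun q : (Y × U) × U => g (q.1.2, q.2)) (by fun_prop)
    unfold residualLeft
    fun_prop
  have m2 : Measurable fun q : Y × U => residualRight g (κ q.1) q.2 := by
    have : Measurable fun q : Y × U => ∫⁻ x, g (x, q.2) ∂(κ q.1) :=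
      Measurable.lintegral_kernel_prod_right' (κ := κ.comap Prod.fst measurable_fst)
        (f := fun q : (Y × U) × U => g (q.2, q.1.2)) (by fun_prop)
    unfold residualRight
    fun_prop
  have m3 : Measurable fun y => ∫⁻ x, residualLeft g (κ' y) x ∂(κ y) :=
    Measurable.lintegral_kernel_prod_right' (κ := κ)
      (f := fun q : Y × U => residualLeft g (κ' q.1) q.2) m1
  unfold completion
  refine (hg.comp measurable_snd).add (Measurable.div (Measurable.mul ?_ ?_)
    (m3.comp measurable_fst))
  · exact m1.comp (measurable_fst.prodMk (measurable_fst.comp measurable_snd))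
  · exact m2.comp (measurable_fst.prodMk (measurable_snd.comp measurable_snd))

lemma completionKernel_apply (hg : Measurable g) (y : Y) [Decidable (IsSubcoupling g (κ y) (κ' y))] :
    completionKernel g κ κ' y = if IsSubcoupling g (κ y) (κ' y) then
      ((κ y).prod (κ' y)).withDensity (completion g (κ y) (κ' y)) else (κ y).prod (κ' y) := by
  classical
  rw [completionKernel, Kernel.withDensity_apply, Kernel.prod_apply]
  · split_ifs
    · rfl
    · exact withDensity_one
  · exact Measurable.ite (measurable_fst (measurableSet_isSubcoupling κ κ' hg))
      (measurable_completion_kernel κ κ' hg) measurable_const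

lemma completionKernel_mem_couplings (hg : Measurable g) (y : Y) :
    completionKernel g κ κ' y ∈ couplings (κ y) (κ' y) := by
  classical
  rw [completionKernel_apply κ κ' hg]
  split_ifs with h
  · exact h.withDensity_completion_mem_couplings hg
  · exact prod_mem_couplings _ _

end Kernel

/-! ### Approximation of couplings by step densities -/

section Approximation

variable {X : Type*} [MeasurableSpace X]

/-- The density with respect to a product measure which is constant, with value
`c.2 (i, j) / c.1`, on the cell where `T` takes the values `i` and `j`. The parameter `c` ranges
over a countable type. -/
def stepDensity (T : X → ℕ) (c : ℕ × (ℕ × ℕ →₀ ℕ)) (z : X × X) : ℝ≥0∞ :=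
  ((c.2 (T z.1, T z.2) / c.1 : ℝ≥0) : ℝ≥0∞)

lemma measurable_stepDensity {T : X → ℕ} (hT : Measurable T) (c : ℕ × (ℕ × ℕ →₀ ℕ)) :
    Measurable (stepDensity T c) := by
  have : Measurable fun q : ℕ × ℕ => ((c.2 q / c.1 : ℝ≥0) : ℝ≥0∞) := measurable_of_countable _
  exact this.comp (by fun_prop : Measurable fun z : X × X => (T z.1, T z.2))

/-- The parameter of the step density that rounds `G` down to a multiple of `1 / n` on the first
`n × n` cells and vanishes on the other cells. For `n = 0` it is the zero density. -/
def roundDown (G : ℕ × ℕ → ℝ≥0) (n : ℕ) : ℕ × (ℕ × ℕ →₀ ℕ) :=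
  (n, Finsupp.onFinset (Finset.range n ×ˢ Finset.range n)
    (fun q => if q ∈ Finset.range n ×ˢ Finset.range n then ⌊G q * n⌋₊ else 0)
    (fun q hq => by by_contra h; simp [h] at hq))

lemma roundDown_div_le (G : ℕ × ℕ → ℝ≥0) (n : ℕ) (q : ℕ × ℕ) :
    ((roundDown G n).2 q : ℝ≥0) / (roundDown G n).1 ≤ G q := by
  rcases Nat.eq_zero_or_pos n with rfl | hn
  · simp [roundDown]
  · have hn' : (0 : ℝ≥0) < n := by exact_mod_cast hn
    simp only [roundDown, Finsupp.onFinset_apply]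
    split_ifs
    · rw [div_le_iff₀ hn']
      exact Nat.floor_le zero_le
    · simp

lemma tendsto_roundDown (G : ℕ × ℕ → ℝ≥0) (q : ℕ × ℕ) :
    Tendsto (fun n => ((roundDown G n).2 q : ℝ≥0) / (roundDown G n).1) atTop (𝓝 (G q)) := by
  have h := (tendsto_nat_floor_mul_div_atTop (R := ℝ) (a := (G q : ℝ)) (G q).2).comp
    tendsto_natCast_atTop_atTop
  rw [← NNReal.tendsto_coe]
  refine h.congr' ?_
  filter_upwards [eventually_gt_atTop (max q.1 q.2)] with n hn
  have : q ∈ Finset.range n ×ˢ Finset.range n := by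
    simp only [Finset.mem_product, Finset.mem_range]; omega
  simp only [roundDown, Finsupp.onFinset_apply, this, if_true, Function.comp]
  push_cast
  congr 2

lemma lintegral_comp_nat {T : X → ℕ} (hT : Measurable T) (m : Measure X) (f : ℕ → ℝ≥0∞) :
    ∫⁻ x, f (T x) ∂m = ∑' i, f i * m (T ⁻¹' {i}) := by
  rw [← lintegral_map (f := f) (measurable_of_countable _) hT, lintegral_countable']
  simp_rw [Measure.map_apply hT (measurableSet_singleton _)]

lemma lintegral_comp_nat_prod {T : X → ℕ} (hT : Measurable T) (m : Measure (X × X))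
    (f : ℕ × ℕ → ℝ≥0∞) :
    ∫⁻ z, f (T z.1, T z.2) ∂m = ∑' q : ℕ × ℕ, f q * m ((T ⁻¹' {q.1}) ×ˢ (T ⁻¹' {q.2})) := by
  have hT2 : Measurable fun z : X × X => (T z.1, T z.2) := by fun_prop
  rw [← lintegral_map (f := f) (measurable_of_countable _) hT2, lintegral_countable']
  simp_rw [Measure.map_apply hT2 (measurableSet_singleton _)]
  congr! 4 with q
  ext z; simp [Prod.ext_iff]

/-- The density of `γ` with respect to `α ⊗ β` at the level of the cells of `T`. It is `0` on null
cells of `α ⊗ β`, which are null for every coupling. -/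
def cellDensity (T : X → ℕ) (α β : Measure X) (γ : Measure (X × X)) (q : ℕ × ℕ) : ℝ≥0 :=
  (γ ((T ⁻¹' {q.1}) ×ˢ (T ⁻¹' {q.2})) / (α (T ⁻¹' {q.1}) * β (T ⁻¹' {q.2}))).toNNReal

variable {α β : Measure X} {γ : Measure (X × X)} {T : X → ℕ}

lemma cellDensity_swap (hT : Measurable T) (i j : ℕ) :
    cellDensity T β α (γ.map Prod.swap) (j, i) = cellDensity T α β γ (i, j) := by
  rw [cellDensity, Measure.map_apply measurable_swap
    ((hT (measurableSet_singleton _)).prod (hT (measurableSet_singleton _))),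
    Set.preimage_swap_prod, mul_comm]
  rfl

/-- The step density that rounds down the cell density of a coupling. -/
def roundedDensity (T : X → ℕ) (α β : Measure X) (γ : Measure (X × X)) (n : ℕ) :
    X × X → ℝ≥0∞ :=
  stepDensity T (roundDown (cellDensity T α β γ) n)

lemma roundedDensity_le (n : ℕ) (z : X × X) :
    roundedDensity T α β γ n z ≤ cellDensity T α β γ (T z.1, T z.2) :=
  ENNReal.coe_le_coe.2 (roundDown_div_le _ _ _)

lemma tendsto_roundedDensity (z : X × X) :
    Tendsto (fun n => roundedDensity T α β γ n z) atTop
      (𝓝 (cellDensity T α β γ (T z.1, T z.2))) :=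
  ENNReal.tendsto_coe.2 (tendsto_roundDown _ _)

variable [IsProbabilityMeasure α] [IsProbabilityMeasure β]

/-- On a null cell both sides vanish, so no absolute continuity is needed. -/
lemma cellDensity_mul (h : γ ∈ couplings α β) (hT : Measurable T) (q : ℕ × ℕ) :
    (cellDensity T α β γ q : ℝ≥0∞) * (α (T ⁻¹' {q.1}) * β (T ⁻¹' {q.2})) =
      γ ((T ⁻¹' {q.1}) ×ˢ (T ⁻¹' {q.2})) := by
  have := isProbabilityMeasure_of_mem_couplings h
  have hi := hT (measurableSet_singleton q.1)
  have hj := hT (measurableSet_singleton q.2)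
  by_cases h0 : α (T ⁻¹' {q.1}) * β (T ⁻¹' {q.2}) = 0
  · rw [h0, mul_zero]
    rcases mul_eq_zero.1 h0 with h0 | h0
    · rw [← h.1, Measure.map_apply measurable_fst hi] at h0
      exact (measure_mono_null (fun z hz => hz.1) h0).symm
    · rw [← h.2, Measure.map_apply measurable_snd hj] at h0
      exact (measure_mono_null (fun z hz => hz.2) h0).symm
  · have hfin : α (T ⁻¹' {q.1}) * β (T ⁻¹' {q.2}) ≠ ∞ := by finiteness
    rw [cellDensity, ENNReal.coe_toNNReal (ENNReal.div_ne_top (measure_ne_top _ _) h0),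
      ENNReal.div_mul_cancel h0 hfin]

lemma ae_lintegral_cellDensity (h : γ ∈ couplings α β) (hT : Measurable T) :
    ∀ᵐ x ∂α, ∫⁻ x', (cellDensity T α β γ (T x, T x') : ℝ≥0∞) ∂β = 1 := by
  have hnull : ∀ᵐ x ∂α, α (T ⁻¹' {T x}) ≠ 0 := by
    have : ∀ᵐ i ∂(α.map T), α.map T {i} ≠ 0 := by
      rw [ae_iff_of_countable]; exact fun i hi => hi
    filter_upwards [ae_of_ae_map hT.aemeasurable this] with x hx
    rwa [Measure.map_apply hT (measurableSet_singleton _)] at hx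
  filter_upwards [hnull] with x hx
  have hi := hT (measurableSet_singleton (T x))
  have key : α (T ⁻¹' {T x}) * ∫⁻ x', (cellDensity T α β γ (T x, T x') : ℝ≥0∞) ∂β =
      α (T ⁻¹' {T x}) := by
    rw [lintegral_comp_nat hT β (fun j => (cellDensity T α β γ (T x, j) : ℝ≥0∞)),
      ← ENNReal.tsum_mul_left]
    have : ∀ j, α (T ⁻¹' {T x}) * (cellDensity T α β γ (T x, j) * β (T ⁻¹' {j})) =
        γ ((T ⁻¹' {T x}) ×ˢ (T ⁻¹' {j})) := by
      intro j
      rw [← cellDensity_mul h hT (T x, j)]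
      ring
    simp_rw [this]
    rw [← measure_iUnion]
    · rw [← h.1, Measure.map_apply measurable_fst hi]
      congr 1
      ext z; simp
    · intro j k hjk
      refine Set.disjoint_left.2 fun z hz hz' => hjk ?_
      have h1 := hz.2; have h2 := hz'.2
      simp only [Set.mem_preimage, Set.mem_singleton_iff] at h1 h2
      omega
    · exact fun j => hi.prod (hT (measurableSet_singleton _))
  have := key.trans (mul_one _).symm
  exact (ENNReal.mul_right_inj hx (measure_ne_top _ _)).1 this

lemma ae_lintegral_cellDensity_left (h : γ ∈ couplings α β) (hT : Measurable T) :
    ∀ᵐ x' ∂β, ∫⁻ x, (cellDensity T α β γ (T x, T x') : ℝ≥0∞) ∂α = 1 := by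
  filter_upwards [ae_lintegral_cellDensity (swap_mem_couplings h) hT] with x' hx'
  simpa only [cellDensity_swap hT] using hx'

lemma isSubcoupling_roundedDensity (h : γ ∈ couplings α β) (hT : Measurable T) (n : ℕ) :
    IsSubcoupling (roundedDensity T α β γ n) α β := by
  constructor
  · rw [← lintegral_zero (μ := α)]
    refine lintegral_congr_ae ?_
    filter_upwards [ae_lintegral_cellDensity h hT] with x hx
    exact tsub_eq_zero_iff_le.2 ((lintegral_mono fun x' => roundedDensity_le n (x, x')).trans hx.le)
  · rw [← lintegral_zero (μ := β)]
    refine lintegral_congr_ae ?_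
    filter_upwards [ae_lintegral_cellDensity_left h hT] with x' hx'
    exact tsub_eq_zero_iff_le.2
      ((lintegral_mono fun x => roundedDensity_le n (x, x')).trans hx'.le)

lemma lintegral_roundedDensity_le (h : γ ∈ couplings α β) (hT : Measurable T) (n : ℕ)
    (f : ℕ × ℕ → ℝ≥0∞) :
    ∫⁻ z, roundedDensity T α β γ n z * f (T z.1, T z.2) ∂(α.prod β) ≤
      ∫⁻ z, f (T z.1, T z.2) ∂γ := by
  calc _ ≤ ∫⁻ z, cellDensity T α β γ (T z.1, T z.2) * f (T z.1, T z.2) ∂(α.prod β) := by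
        gcongr with z; exact roundedDensity_le n z
    _ = ∫⁻ z, f (T z.1, T z.2) ∂γ := by
        rw [lintegral_comp_nat_prod hT (α.prod β) (fun q => cellDensity T α β γ q * f q),
          lintegral_comp_nat_prod hT γ]
        congr! 2 with q
        rw [← cellDensity_mul h hT q, Measure.prod_prod]
        ring

/-- By dominated convergence the first marginal of the rounded densities exhausts `α`. -/
lemma tendsto_residualLeft (h : γ ∈ couplings α β) (hT : Measurable T) :
    ∀ᵐ x ∂α, Tendsto (fun n => residualLeft (roundedDensity T α β γ n) β x) atTop (𝓝 0) := by
  filter_upwards [ae_lintegral_cellDensity h hT] with x hx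
  have : Tendsto (fun n => ∫⁻ x', roundedDensity T α β γ n (x, x') ∂β) atTop (𝓝 1) := by
    rw [← hx]
    refine tendsto_lintegral_of_dominated_convergence _ (fun n => ?_)
      (fun n => Eventually.of_forall fun x' => roundedDensity_le n (x, x')) (by simp [hx])
      (Eventually.of_forall fun x' => tendsto_roundedDensity (x, x'))
    exact (measurable_stepDensity hT _).comp measurable_prodMk_left
  simpa [residualLeft] using
    ENNReal.Tendsto.sub (tendsto_const_nhds (x := (1 : ℝ≥0∞))) this (by simp)

lemma tendsto_residualRight (h : γ ∈ couplings α β) (hT : Measurable T) :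
    ∀ᵐ x ∂β, Tendsto (fun n => residualRight (roundedDensity T α β γ n) α x) atTop (𝓝 0) := by
  filter_upwards [ae_lintegral_cellDensity_left h hT] with x' hx
  have : Tendsto (fun n => ∫⁻ x, roundedDensity T α β γ n (x, x') ∂α) atTop (𝓝 1) := by
    rw [← hx]
    refine tendsto_lintegral_of_dominated_convergence _ (fun n => ?_)
      (fun n => Eventually.of_forall fun x => roundedDensity_le n (x, x')) (by simp [hx])
      (Eventually.of_forall fun x => tendsto_roundedDensity (x, x'))
    exact (measurable_stepDensity hT _).comp measurable_prodMk_right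
  simpa [residualRight] using
    ENNReal.Tendsto.sub (tendsto_const_nhds (x := (1 : ℝ≥0∞))) this (by simp)

lemma tendsto_lintegral_mul_of_le_one {m : Measure X} {φ : X → ℝ≥0∞} (hφ : Measurable φ)
    (hfin : ∫⁻ x, φ x ∂m ≠ ∞) {ρ : ℕ → X → ℝ≥0∞} (hρ : ∀ n, Measurable (ρ n))
    (hle : ∀ n x, ρ n x ≤ 1) (hlim : ∀ᵐ x ∂m, Tendsto (fun n => ρ n x) atTop (𝓝 0)) :
    Tendsto (fun n => ∫⁻ x, φ x * ρ n x ∂m) atTop (𝓝 0) := by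
  rw [← lintegral_zero (μ := m)]
  refine tendsto_lintegral_of_dominated_convergence φ (fun n => hφ.mul (hρ n))
    (fun n => Eventually.of_forall fun x => mul_le_of_le_one_right' (hle n x)) hfin ?_
  filter_upwards [hlim, ae_lt_top hφ hfin] with x hx hφx
  simpa using ENNReal.Tendsto.const_mul hx (Or.inr hφx.ne)

end Approximation

section Selection

variable {U : Type*} [NormedAddCommGroup U] [MeasurableSpace U] [BorelSpace U]
  [SecondCountableTopology U]

/-- A space is cut into countably many measurable cells close to the points of a sequence. -/
lemma exists_cells (U : Type*) [NormedAddCommGroup U] [MeasurableSpace U] [BorelSpace U]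
    [SecondCountableTopology U] {ε : ℝ≥0} (hε : 0 < ε) :
    ∃ T : U → ℕ, Measurable T ∧ ∀ x, edist x (TopologicalSpace.denseSeq U (T x)) ≤ ε := by
  classical
  have hex : ∀ x : U, ∃ n, edist x (TopologicalSpace.denseSeq U n) < ε := fun x =>
    by
    obtain ⟨n, hn⟩ := (TopologicalSpace.denseRange_denseSeq U).exists_dist_lt x
      (NNReal.coe_pos.2 hε)
    exact ⟨n, by rw [edist_nndist]; exact_mod_cast hn⟩
  refine ⟨fun x => Nat.find (hex x), measurable_find hex fun n => ?_,
    fun x => (Nat.find_spec (hex x)).le⟩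
  exact measurableSet_lt (by fun_prop) measurable_const

/-- A coupling is matched in cost, up to the diameter of the cells, by completed step
densities. -/
lemma exists_stepDensity_cost_le {p : ℝ} (hp : 1 ≤ p) {ε : ℝ≥0} {T : U → ℕ}
    (hT : Measurable T) (hTε : ∀ x, edist x (TopologicalSpace.denseSeq U (T x)) ≤ ε)
    {α β : Measure U} [IsProbabilityMeasure α] [IsProbabilityMeasure β]
    (hα : HasFiniteMoment p α) (hβ : HasFiniteMoment p β) {γ : Measure (U × U)}
    (h : γ ∈ couplings α β) {δ : ℝ≥0∞} (hδ : 0 < δ) :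
    ∃ c, IsSubcoupling (stepDensity T c) α β ∧
      cost p ((α.prod β).withDensity (completion (stepDensity T c) α β)) ≤
        ∫⁻ z, (edist z.1 z.2 + 4 * ε) ^ p ∂γ + δ := by
  have hp0 : 0 ≤ p := by linarith
  have lim1 := tendsto_lintegral_mul_of_le_one (by fun_prop) hα.ne
    (fun n => measurable_residualLeft (measurable_stepDensity hT _))
    (fun n x => tsub_le_self) (tendsto_residualLeft h hT)
  have lim2 := tendsto_lintegral_mul_of_le_one (by fun_prop) hβ.ne
    (fun n => measurable_residualRight (measurable_stepDensity hT _))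
    (fun n x => tsub_le_self) (tendsto_residualRight h hT)
  have lim := ENNReal.Tendsto.const_mul (lim1.add lim2) (Or.inr (two_rpow_ne_top p hp))
  rw [add_zero, mul_zero] at lim
  obtain ⟨n, hn⟩ := (lim.eventually_lt_const hδ).exists
  refine ⟨roundDown (cellDensity T α β γ) n, isSubcoupling_roundedDensity h hT n, ?_⟩
  refine ((isSubcoupling_roundedDensity h hT n).cost_completion_le hp
    (measurable_stepDensity hT _)).trans (add_le_add ?_ hn.le)
  -- the distance between two cells, up to their diameter
  let f : ℕ × ℕ → ℝ≥0∞ := fun q =>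
    (edist (TopologicalSpace.denseSeq U q.1) (TopologicalSpace.denseSeq U q.2) + 2 * ε) ^ p
  calc ∫⁻ z, roundedDensity T α β γ n z * edist z.1 z.2 ^ p ∂(α.prod β)
      ≤ ∫⁻ z, roundedDensity T α β γ n z * f (T z.1, T z.2) ∂(α.prod β) := by
        gcongr with z
        refine ENNReal.rpow_le_rpow ?_ hp0
        calc edist z.1 z.2 ≤ _ := edist_triangle4 _ (TopologicalSpace.denseSeq U (T z.1))
              (TopologicalSpace.denseSeq U (T z.2)) _
          _ ≤ ε + edist (TopologicalSpace.denseSeq U (T z.1))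
              (TopologicalSpace.denseSeq U (T z.2)) + ε := by
            gcongr
            · exact hTε _
            · rw [edist_comm]; exact hTε _
          _ = _ := by ring
    _ ≤ ∫⁻ z, f (T z.1, T z.2) ∂γ := lintegral_roundedDensity_le h hT n f
    _ ≤ ∫⁻ z, (edist z.1 z.2 + 4 * ε) ^ p ∂γ := by
        gcongr with z
        refine ENNReal.rpow_le_rpow ?_ hp0
        calc _ ≤ edist (TopologicalSpace.denseSeq U (T z.1)) z.1 + edist z.1 z.2 +
              edist z.2 (TopologicalSpace.denseSeq U (T z.2)) + 2 * ε := by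
              gcongr; exact edist_triangle4 _ _ _ _
          _ ≤ ε + edist z.1 z.2 + ε + 2 * ε := by
            gcongr
            · rw [edist_comm]; exact hTε _
            · exact hTε _
          _ = _ := by ring

lemma exists_lintegral_edist_add_rpow_le {p : ℝ} (hp : 1 ≤ p) {γ : Measure (U × U)}
    [IsProbabilityMeasure γ] (hγ : cost p γ ≠ ∞) {δ : ℝ≥0∞} (hδ : 0 < δ) :
    ∃ k : ℕ, ∫⁻ z, (edist z.1 z.2 + 4 * ((1 / (k + 1) : ℝ≥0) : ℝ≥0∞)) ^ p ∂γ ≤ cost p γ + δ := by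
  have hp0 : 0 < p := by linarith
  have h0 : Tendsto (fun k : ℕ => 4 * ((1 / (k + 1) : ℝ≥0) : ℝ≥0∞)) atTop (𝓝 0) := by
    have : Tendsto (fun k : ℕ => ((1 / (k + 1) : ℝ≥0) : ℝ≥0∞)) atTop (𝓝 ((0 : ℝ≥0) : ℝ≥0∞)) :=
      ENNReal.tendsto_coe.2 tendsto_one_div_add_atTop_nhds_zero_nat
    simpa using ENNReal.Tendsto.const_mul this (Or.inr (by simp))
  have h1 : Tendsto (fun k : ℕ =>
      (cost p γ ^ (1 / p) + 4 * ((1 / (k + 1) : ℝ≥0) : ℝ≥0∞)) ^ p) atTop (𝓝 (cost p γ)) := by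
    have := (ENNReal.continuous_rpow_const (y := p)).continuousAt.tendsto.comp
      ((tendsto_const_nhds (x := cost p γ ^ (1 / p))).add h0)
    rwa [add_zero, ← ENNReal.rpow_mul, one_div_mul_cancel hp0.ne', ENNReal.rpow_one] at this
  obtain ⟨k, hk⟩ := (h1.eventually_lt_const (ENNReal.lt_add_right hγ hδ.ne')).exists
  refine ⟨k, le_trans ?_ hk.le⟩
  have := ENNReal.lintegral_Lp_add_le (μ := γ) (f := fun z : U × U => edist z.1 z.2)
    (g := fun _ => 4 * ((1 / (k + 1) : ℝ≥0) : ℝ≥0∞)) (by fun_prop) (by fun_prop) hp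
  simp only [Pi.add_apply, lintegral_const, measure_univ, mul_one] at this
  rw [← ENNReal.rpow_mul _ p, mul_one_div_cancel hp0.ne', ENNReal.rpow_one] at this
  have h2 := ENNReal.rpow_le_rpow this hp0.le
  rwa [← ENNReal.rpow_mul, one_div_mul_cancel hp0.ne', ENNReal.rpow_one] at h2

variable {Y : Type*} [MeasurableSpace Y]

/-- Countably many coupling kernels suffice to compute every fibrewise Wasserstein distance. -/
theorem exists_couplingKernel_seq {p : ℝ} (hp : 1 ≤ p) (κ κ' : Kernel Y U) [IsMarkovKernel κ]
    [IsMarkovKernel κ'] :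
    ∃ K : ℕ → Kernel Y (U × U), (∀ n y, K n y ∈ couplings (κ y) (κ' y)) ∧
      ∀ y, HasFiniteMoment p (κ y) → HasFiniteMoment p (κ' y) →
        ⨅ n, cost p (K n y) = wasserstein p (κ y) (κ' y) ^ p := by
  classical
  have hp0 : 0 < p := by linarith
  choose T hT hTε using fun k : ℕ => exists_cells U (ε := 1 / (k + 1)) (by positivity)
  -- one kernel for each mesh `1 / (k + 1)` and each step density on its cells
  obtain ⟨e, he⟩ := exists_surjective_nat (ℕ × (ℕ × (ℕ × ℕ →₀ ℕ)))
  refine ⟨fun n => completionKernel (stepDensity (T (e n).1) (e n).2) κ κ', fun n y =>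
    completionKernel_mem_couplings κ κ' (measurable_stepDensity (hT _) _) y, fun y h1 h2 => ?_⟩
  apply le_antisymm
  · rw [wasserstein_rpow hp0]
    refine le_iInf₂ fun γ hγ => ENNReal.le_of_forall_pos_le_add fun δ hδ hlt => ?_
    have := isProbabilityMeasure_of_mem_couplings hγ
    have hδ2 : (0 : ℝ≥0∞) < δ / 2 := ENNReal.half_pos (by exact_mod_cast hδ.ne')
    obtain ⟨k, hk⟩ := exists_lintegral_edist_add_rpow_le hp hlt.ne hδ2
    obtain ⟨c, hc, hle⟩ := exists_stepDensity_cost_le hp (hT k) (hTε k) h1 h2 hγ hδ2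
    obtain ⟨n, hn⟩ := he (k, c)
    refine (iInf_le _ n).trans ?_
    simp only [hn]
    rw [completionKernel_apply κ κ' (measurable_stepDensity (hT _) _), if_pos hc]
    calc _ ≤ _ := hle
      _ ≤ cost p γ + δ / 2 + δ / 2 := by gcongr
      _ = _ := by rw [add_assoc, ENNReal.add_halves]
  · exact le_iInf fun n => wasserstein_rpow_le_cost hp0
      (completionKernel_mem_couplings κ κ' (measurable_stepDensity (hT _) _) y)

lemma measurable_cost_kernel (p : ℝ) (K : Kernel Y (U × U)) : Measurable fun y => cost p (K y) :=
  (measurable_edist_rpow p).lintegral_kernel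

variable {μ : Measure Y}

/-- The fibrewise Wasserstein distance is the infimum of countably many measurable functions. -/
theorem aemeasurable_wasserstein_rpow {p : ℝ} (hp : 1 ≤ p) (κ κ' : Kernel Y U)
    [IsMarkovKernel κ] [IsMarkovKernel κ'] (h : ∀ᵐ y ∂μ, HasFiniteMoment p (κ y))
    (h' : ∀ᵐ y ∂μ, HasFiniteMoment p (κ' y)) :
    AEMeasurable (fun y => wasserstein p (κ y) (κ' y) ^ p) μ := by
  obtain ⟨K, -, hK⟩ := exists_couplingKernel_seq hp κ κ'
  refine ⟨fun y => ⨅ n, cost p (K n y), .iInf fun n => measurable_cost_kernel p (K n), ?_⟩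
  filter_upwards [h, h'] with y h1 h2 using (hK y h1 h2).symm

/-- Near-optimal couplings can be chosen measurably: take the first one of a sequence of coupling
kernels whose cost is close to the infimum. -/
theorem exists_couplingKernel_cost_le {p : ℝ} (hp : 1 ≤ p) (κ κ' : Kernel Y U)
    [IsMarkovKernel κ] [IsMarkovKernel κ'] {δ : ℝ≥0∞} (hδ : 0 < δ) :
    ∃ K : Kernel Y (U × U), (∀ y, K y ∈ couplings (κ y) (κ' y)) ∧
      ∀ y, HasFiniteMoment p (κ y) → HasFiniteMoment p (κ' y) →
        cost p (K y) ≤ wasserstein p (κ y) (κ' y) ^ p + δ := by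
  classical
  obtain ⟨K, hKc, hK⟩ := exists_couplingKernel_seq hp κ κ'
  have hex : ∀ y, ∃ n, cost p (K n y) ≤ (⨅ n, cost p (K n y)) + δ := by
    intro y
    rcases eq_or_ne (⨅ n, cost p (K n y)) ∞ with hinf | hinf
    · exact ⟨0, by simp [hinf]⟩
    · obtain ⟨n, hn⟩ := iInf_lt_iff.1 (ENNReal.lt_add_right hinf hδ.ne')
      exact ⟨n, hn.le⟩
  have hm : ∀ n, MeasurableSet {y | cost p (K n y) ≤ (⨅ n, cost p (K n y)) + δ} := fun n =>
    measurableSet_le (measurable_cost_kernel p (K n))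
      ((Measurable.iInf fun n => measurable_cost_kernel p (K n)).add measurable_const)
  refine ⟨⟨fun y => K (Nat.find (hex y)) y, Measurable.find (fun n => (K n).measurable) hm hex⟩,
    fun y => hKc _ y, fun y h1 h2 => ?_⟩
  rw [← hK y h1 h2]
  exact Nat.find_spec (hex y)

end Selection

/-! ### Existence of cost-minimizing couplings -/

section Minimizer

variable {X : Type*} [MetricSpace X] [MeasurableSpace X] [BorelSpace X]
  [SecondCountableTopology X]

lemma lowerSemicontinuous_cost {p : ℝ} (hp : 0 < p) :
    LowerSemicontinuous fun γ : ProbabilityMeasure (X × X) => cost p (γ : Measure (X × X)) := by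
  -- the cost is the supremum of the integrals of its bounded continuous truncations
  let f : ℕ → BoundedContinuousFunction (X × X) ℝ≥0 := fun n =>
    BoundedContinuousFunction.mkOfBound
      ⟨fun z => min (nndist z.1 z.2 ^ p) n,
        ((NNReal.continuous_rpow_const hp.le).comp
          (continuous_fst.nndist continuous_snd)).min continuous_const⟩ n (fun x y => by
        rw [NNReal.dist_eq]
        have h1 : ((min (nndist x.1 x.2 ^ p) n : ℝ≥0) : ℝ) ≤ n :=
          NNReal.coe_le_coe.2 (min_le_right _ _)
        have h2 : ((min (nndist y.1 y.2 ^ p) n : ℝ≥0) : ℝ) ≤ n :=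
          NNReal.coe_le_coe.2 (min_le_right _ _)
        have h3 : (0 : ℝ) ≤ (min (nndist x.1 x.2 ^ p) n : ℝ≥0) := NNReal.coe_nonneg _
        have h4 : (0 : ℝ) ≤ (min (nndist y.1 y.2 ^ p) n : ℝ≥0) := NNReal.coe_nonneg _
        change |((min (nndist x.1 x.2 ^ p) n : ℝ≥0) : ℝ) - (min (nndist y.1 y.2 ^ p) n : ℝ≥0)| ≤ n
        rw [abs_le]; constructor <;> linarith)
  have hf : ∀ n z, f n z = min (nndist z.1 z.2 ^ p) n := fun n z => rfl
  have key : ∀ γ : ProbabilityMeasure (X × X),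
      cost p (γ : Measure (X × X)) = ⨆ n, ∫⁻ z, f n z ∂(γ : Measure (X × X)) := by
    intro γ
    rw [← lintegral_iSup (fun n => (f n).continuous.measurable.coe_nnreal_ennreal)]
    · refine lintegral_congr fun z => ?_
      have hz : edist z.1 z.2 ^ p = ((nndist z.1 z.2 ^ p : ℝ≥0) : ℝ≥0∞) := by
        rw [edist_nndist, ENNReal.coe_rpow_of_nonneg _ hp.le]
      simp only [hf, hz]
      apply le_antisymm
      · obtain ⟨n, hn⟩ := exists_nat_ge (nndist z.1 z.2 ^ p)
        exact le_iSup_of_le n (by rw [min_eq_left hn])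
      · exact iSup_le fun n => ENNReal.coe_le_coe.2 (min_le_left _ _)
    · intro m n hmn z
      simp only [hf]
      gcongr
  simp_rw [key]
  exact lowerSemicontinuous_iSup fun n =>
    (ProbabilityMeasure.continuous_lintegral_boundedContinuousFunction (f n)).lowerSemicontinuous

/-- Couplings of two fixed laws form a tight set, so the cost attains its minimum on each nonempty
weakly closed set of couplings. -/
lemma exists_forall_cost_le [CompleteSpace X] {p : ℝ} (hp : 0 < p) {η ν : Measure X}
    [IsProbabilityMeasure η] [IsProbabilityMeasure ν] {S : Set (ProbabilityMeasure (X × X))}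
    (hS : IsClosed S) (hne : S.Nonempty)
    (hSc : ∀ γ ∈ S, (γ : Measure (X × X)) ∈ couplings η ν) :
    ∃ γ ∈ S, ∀ γ' ∈ S, cost p (γ : Measure (X × X)) ≤ cost p (γ' : Measure (X × X)) := by
  have htight : IsTightMeasureSet {((γ : ProbabilityMeasure (X × X)) : Measure (X × X)) | γ ∈ S} := by
    apply IsTightMeasureSet.prodMk
    · refine (isTightMeasureSet_singleton (μ := η)).subset ?_
      rintro _ ⟨_, ⟨γ, hγ, rfl⟩, rfl⟩
      exact (hSc γ hγ).1
    · refine (isTightMeasureSet_singleton (μ := ν)).subset ?_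
      rintro _ ⟨_, ⟨γ, hγ, rfl⟩, rfl⟩
      exact (hSc γ hγ).2
  have hcomp := isCompact_closure_of_isTightMeasureSet htight
  rw [hS.closure_eq] at hcomp
  obtain ⟨γ, hγ, hmin⟩ := ((lowerSemicontinuous_cost hp).lowerSemicontinuousOn S).exists_isMinOn
    hne hcomp
  exact ⟨γ, hγ, fun γ' hγ' => hmin hγ'⟩

end Minimizer

/-! ### Triangular couplings as families of couplings of the fibres -/

lemma measurable_withLp_fst {Y U : Type*} [MeasurableSpace Y] [MeasurableSpace U] :
    Measurable (WithLp.fst : WithLp 2 (Y × U) → Y) :=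
  measurable_fst.comp (WithLp.measurable_ofLp 2 (Y × U))

lemma measurable_withLp_snd {Y U : Type*} [MeasurableSpace Y] [MeasurableSpace U] :
    Measurable (WithLp.snd : WithLp 2 (Y × U) → U) :=
  measurable_snd.comp (WithLp.measurable_ofLp 2 (Y × U))

lemma edist_toLp_of_fst_eq {Y U : Type*} [PseudoEMetricSpace Y] [PseudoEMetricSpace U]
    (y : Y) (u u' : U) :
    edist (WithLp.toLp 2 (y, u)) (WithLp.toLp 2 (y, u')) = edist u u' := by
  rw [WithLp.prod_edist_eq_add (by norm_num)]
  simp only [WithLp.toLp_fst, WithLp.toLp_snd, edist_self, ENNReal.toReal_ofNat]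
  rw [ENNReal.zero_rpow_of_pos (by norm_num), zero_add, ← ENNReal.rpow_mul]
  norm_num

section Disintegration

variable {Y U : Type*} [MeasurableSpace Y] [MeasurableSpace U]

/-- The law on `(Y × U)²` of `((y, u₀), (y, u₁))`, where `y` has law `μ` and `(u₀, u₁)` has law
`K y`. -/
def triangularOfKernel (μ : Measure Y) (K : Kernel Y (U × U)) :
    Measure (WithLp 2 (Y × U) × WithLp 2 (Y × U)) :=
  (μ.compProd K).map (fun q => (WithLp.toLp 2 (q.1, q.2.1), WithLp.toLp 2 (q.1, q.2.2)))

lemma map_toLp_compProd {μ : Measure Y} {κ : Kernel Y U} {η : Measure (WithLp 2 (Y × U))}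
    (h : μ.compProd κ = η.map WithLp.ofLp) : (μ.compProd κ).map (WithLp.toLp 2) = η := by
  rw [h, Measure.map_map (WithLp.measurable_toLp 2 _) (WithLp.measurable_ofLp 2 _)]
  exact Measure.map_id

lemma map_compProd_kernel {μ : Measure Y} [SFinite μ] {K : Kernel Y (U × U)} [IsSFiniteKernel K]
    {f : U × U → U} (hf : Measurable f) :
    (μ.compProd K).map (fun q => (q.1, f q.2)) = μ.compProd (K.map f) := by
  rw [Measure.compProd_map hf]
  rfl

lemma isMarkovKernel_of_couplings {κ κ' : Kernel Y U} {K : Kernel Y (U × U)} [IsMarkovKernel κ]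
    (hK : ∀ y, K y ∈ couplings (κ y) (κ' y)) : IsMarkovKernel K :=
  ⟨fun y => isProbabilityMeasure_of_mem_couplings (hK y)⟩

lemma triangularOfKernel_mem {μ : Measure Y} [IsProbabilityMeasure μ] {κ κ' : Kernel Y U}
    {η ν : Measure (WithLp 2 (Y × U))} [IsMarkovKernel κ] (hη : μ.compProd κ = η.map WithLp.ofLp)
    (hν : μ.compProd κ' = ν.map WithLp.ofLp) {K : Kernel Y (U × U)}
    (hK : ∀ y, K y ∈ couplings (κ y) (κ' y)) :
    triangularOfKernel μ K ∈ triangularCouplings μ η ν := by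
  have := isMarkovKernel_of_couplings hK
  have hm : Measurable fun q : Y × (U × U) =>
      ((WithLp.toLp 2 (q.1, q.2.1), WithLp.toLp 2 (q.1, q.2.2)) :
        WithLp 2 (Y × U) × WithLp 2 (Y × U)) := by fun_prop
  have mf := measurable_withLp_fst (Y := Y) (U := U)
  have mff : Measurable fun z : WithLp 2 (Y × U) × WithLp 2 (Y × U) => (z.1.fst, z.2.fst) := by
    fun_prop
  have e1 : K.map Prod.fst = κ := by
    ext1 y; rw [Kernel.map_apply _ measurable_fst]; exact (hK y).1
  have e2 : K.map Prod.snd = κ' := by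
    ext1 y; rw [Kernel.map_apply _ measurable_snd]; exact (hK y).2
  refine ⟨⟨?_, ?_⟩, ?_⟩
  · rw [triangularOfKernel, Measure.map_map measurable_fst hm, ← map_toLp_compProd hη, ← e1,
      ← map_compProd_kernel measurable_fst, Measure.map_map (WithLp.measurable_toLp 2 _) (by fun_prop)]
    rfl
  · rw [triangularOfKernel, Measure.map_map measurable_snd hm, ← map_toLp_compProd hν, ← e2,
      ← map_compProd_kernel measurable_snd, Measure.map_map (WithLp.measurable_toLp 2 _) (by fun_prop)]
    rfl
  · rw [triangularOfKernel, Measure.map_map mff hm]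
    conv_rhs => rw [← Measure.fst_compProd μ K, Measure.fst]
    rw [Measure.map_map (by fun_prop) measurable_fst]
    rfl

end Disintegration

lemma ae_fst_eq_of_triangular {Y U : Type*} [NormedAddCommGroup Y] [SecondCountableTopology Y]
    [MeasurableSpace Y] [BorelSpace Y] [MeasurableSpace U] {η ν : Measure (WithLp 2 (Y × U))} {μ : Measure Y}
    {γ : Measure (WithLp 2 (Y × U) × WithLp 2 (Y × U))} (hγ : γ ∈ triangularCouplings μ η ν) :
    ∀ᵐ z ∂γ, z.1.fst = z.2.fst := by
  have mf := measurable_withLp_fst (Y := Y) (U := U)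
  have mff : Measurable fun z : WithLp 2 (Y × U) × WithLp 2 (Y × U) => (z.1.fst, z.2.fst) := by
    fun_prop
  have hdiag : Measurable fun y : Y => (y, y) := by fun_prop
  have : ∀ᵐ w ∂(γ.map fun z => (z.1.fst, z.2.fst)), w.1 = w.2 := by
    rw [hγ.2, ae_map_iff hdiag.aemeasurable (measurableSet_eq_fun measurable_fst measurable_snd)]
    exact Eventually.of_forall fun y => rfl
  exact ae_of_ae_map mff.aemeasurable this

section Joint

variable {Y U : Type*}
  [NormedAddCommGroup Y] [SecondCountableTopology Y] [MeasurableSpace Y] [BorelSpace Y]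
  [NormedAddCommGroup U] [SecondCountableTopology U] [MeasurableSpace U] [BorelSpace U]

variable {μ : Measure Y} [IsProbabilityMeasure μ] {κ κ' : Kernel Y U}
  {η ν : Measure (WithLp 2 (Y × U))}

lemma cost_triangularOfKernel (p : ℝ) (K : Kernel Y (U × U)) [IsSFiniteKernel K] :
    cost p (triangularOfKernel μ K) = ∫⁻ y, cost p (K y) ∂μ := by
  rw [cost, triangularOfKernel, lintegral_map (measurable_edist_rpow p) (by fun_prop)]
  simp only [edist_toLp_of_fst_eq]
  rw [Measure.lintegral_compProd (f := fun q : Y × (U × U) => edist q.2.1 q.2.2 ^ p)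
    (by fun_prop)]
  rfl

variable [CompleteSpace U]

/-- Disintegrating a triangular coupling along the common `Y`-coordinate yields couplings of the
fibres, whence the lower bound for its cost. -/
lemma lintegral_wasserstein_le_cost {p : ℝ} (hp : 0 < p) [IsMarkovKernel κ] [IsMarkovKernel κ']
    (hη : μ.compProd κ = η.map WithLp.ofLp) (hν : μ.compProd κ' = ν.map WithLp.ofLp)
    {γ : Measure (WithLp 2 (Y × U) × WithLp 2 (Y × U))} (hγ : γ ∈ triangularCouplings μ η ν) :
    ∫⁻ y, wasserstein p (κ y) (κ' y) ^ p ∂μ ≤ cost p γ := by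
  have mf := measurable_withLp_fst (Y := Y) (U := U)
  have ms := measurable_withLp_snd (Y := Y) (U := U)
  have mff : Measurable fun z : WithLp 2 (Y × U) × WithLp 2 (Y × U) => (z.1.fst, z.2.fst) := by
    fun_prop
  have hdiag : Measurable fun y : Y => (y, y) := by fun_prop
  have hae := ae_fst_eq_of_triangular hγ
  obtain ⟨⟨h1, h2⟩, h3⟩ := hγ
  let π : WithLp 2 (Y × U) × WithLp 2 (Y × U) → Y × (U × U) :=
    fun z => (z.1.fst, (z.1.snd, z.2.snd))
  have mπ : Measurable π := by fun_prop
  have hfst : (γ.map π).fst = μ := by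
    have : μ = (γ.map fun z => (z.1.fst, z.2.fst)).map Prod.fst := by
      rw [h3, Measure.map_map measurable_fst hdiag]; exact Measure.map_id.symm
    rw [this, Measure.fst, Measure.map_map measurable_fst mπ, Measure.map_map measurable_fst mff]
    rfl
  have : IsProbabilityMeasure (γ.map π) := by
    have : IsProbabilityMeasure ((γ.map π).map Prod.fst) := by
      rw [← Measure.fst, hfst]; infer_instance
    exact Measure.isProbabilityMeasure_of_map (Prod.fst : Y × (U × U) → Y)
  set K := (γ.map π).condKernel
  have hK : μ.compProd K = γ.map π := by rw [← hfst]; exact Measure.disintegrate _ _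
  have c1 : K.map Prod.fst =ᵐ[μ] κ := by
    refine Kernel.ae_eq_of_compProd_eq ?_
    rw [← map_compProd_kernel measurable_fst, hK, hη, ← h1,
      Measure.map_map (by fun_prop) mπ, Measure.map_map (by fun_prop) measurable_fst]
    rfl
  have c2 : K.map Prod.snd =ᵐ[μ] κ' := by
    refine Kernel.ae_eq_of_compProd_eq ?_
    rw [← map_compProd_kernel measurable_snd, hK, hν, ← h2,
      Measure.map_map (by fun_prop) mπ, Measure.map_map (by fun_prop) measurable_snd]
    refine Measure.map_congr ?_
    filter_upwards [hae] with z hz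
    exact Prod.ext hz rfl
  calc ∫⁻ y, wasserstein p (κ y) (κ' y) ^ p ∂μ ≤ ∫⁻ y, cost p (K y) ∂μ := by
        refine lintegral_mono_ae ?_
        filter_upwards [c1, c2] with y h1 h2
        rw [Kernel.map_apply _ measurable_fst] at h1
        rw [Kernel.map_apply _ measurable_snd] at h2
        exact wasserstein_rpow_le_cost hp ⟨h1, h2⟩
    _ = ∫⁻ q, edist q.2.1 q.2.2 ^ p ∂(μ.compProd K) := by
        rw [Measure.lintegral_compProd (by fun_prop)]; rfl
    _ = ∫⁻ z, edist z.1.snd z.2.snd ^ p ∂γ := by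
        rw [hK, lintegral_map (by fun_prop) mπ]
    _ ≤ cost p γ := by
        refine lintegral_mono fun z => ENNReal.rpow_le_rpow ?_ hp.le
        exact WithLp.edist_snd_le z.1 z.2

variable [CompleteSpace Y]

/-- The triangularity constraint is weakly closed, so the minimal cost is attained. -/
lemma exists_triangular_minimizer {p : ℝ} (hp : 0 < p) [IsProbabilityMeasure η]
    [IsProbabilityMeasure ν] (hne : (triangularCouplings μ η ν).Nonempty) :
    ∃ γ ∈ triangularCouplings μ η ν, ∀ γ' ∈ triangularCouplings μ η ν, cost p γ ≤ cost p γ' := by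
  have cf : Continuous (WithLp.fst : WithLp 2 (Y × U) → Y) := WithLp.continuous_fst 2 Y U
  have cff : Continuous fun z : WithLp 2 (Y × U) × WithLp 2 (Y × U) => (z.1.fst, z.2.fst) := by
    fun_prop
  have : IsProbabilityMeasure (μ.map fun y => (y, y)) :=
    Measure.isProbabilityMeasure_map (by fun_prop)
  let S : Set (ProbabilityMeasure (WithLp 2 (Y × U) × WithLp 2 (Y × U))) :=
    {γ | γ.map continuous_fst.measurable.aemeasurable = ⟨η, inferInstance⟩} ∩
    {γ | γ.map continuous_snd.measurable.aemeasurable = ⟨ν, inferInstance⟩} ∩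
    {γ | γ.map cff.measurable.aemeasurable = ⟨μ.map fun y => (y, y), inferInstance⟩}
  have hS : IsClosed S :=
    ((isClosed_singleton.preimage (ProbabilityMeasure.continuous_map continuous_fst)).inter
      (isClosed_singleton.preimage (ProbabilityMeasure.continuous_map continuous_snd))).inter
      (isClosed_singleton.preimage (ProbabilityMeasure.continuous_map cff))
  have hmem : ∀ γ : ProbabilityMeasure (WithLp 2 (Y × U) × WithLp 2 (Y × U)),
      γ ∈ S ↔ (γ : Measure _) ∈ triangularCouplings μ η ν := by
    intro γ
    exact and_congr (and_congr Subtype.ext_iff Subtype.ext_iff) Subtype.ext_iff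
  have hprob : ∀ γ ∈ triangularCouplings μ η ν, IsProbabilityMeasure γ := fun γ hγ =>
    isProbabilityMeasure_of_mem_couplings hγ.1
  obtain ⟨γ₀, hγ₀⟩ := hne
  obtain ⟨γ, hγ, hmin⟩ := exists_forall_cost_le hp hS ⟨⟨γ₀, hprob γ₀ hγ₀⟩, (hmem _).2 hγ₀⟩
    (fun γ hγ => ((hmem γ).1 hγ).1)
  exact ⟨γ, (hmem γ).1 hγ, fun γ' hγ' => hmin ⟨γ', hprob γ' hγ'⟩ ((hmem _).2 hγ')⟩

/-- The mean fibrewise cost is the minimal cost of a triangular coupling. -/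
theorem isLeast_cost_triangularCouplings {p : ℝ} (hp : 1 ≤ p) [IsProbabilityMeasure η]
    [IsProbabilityMeasure ν] [IsMarkovKernel κ] [IsMarkovKernel κ']
    (hη : μ.compProd κ = η.map WithLp.ofLp) (hν : μ.compProd κ' = ν.map WithLp.ofLp)
    (h : ∀ᵐ y ∂μ, HasFiniteMoment p (κ y)) (h' : ∀ᵐ y ∂μ, HasFiniteMoment p (κ' y)) :
    IsLeast (cost p '' triangularCouplings μ η ν) (∫⁻ y, wasserstein p (κ y) (κ' y) ^ p ∂μ) := by
  have hp0 : 0 < p := by linarith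
  obtain ⟨γ, hγ, hmin⟩ := exists_triangular_minimizer hp0
    ⟨_, triangularOfKernel_mem hη hν (K := κ ×ₖ κ') fun y => by
      rw [Kernel.prod_apply]; exact prod_mem_couplings _ _⟩
  refine ⟨⟨γ, hγ, le_antisymm ?_ (lintegral_wasserstein_le_cost hp0 hη hν hγ)⟩, ?_⟩
  · refine ENNReal.le_of_forall_pos_le_add fun δ hδ _ => ?_
    obtain ⟨K, hK, hKδ⟩ := exists_couplingKernel_cost_le hp κ κ' (δ := δ) (by exact_mod_cast hδ)
    have := isMarkovKernel_of_couplings hK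
    calc cost p γ ≤ cost p (triangularOfKernel μ K) := hmin _ (triangularOfKernel_mem hη hν hK)
      _ = ∫⁻ y, cost p (K y) ∂μ := cost_triangularOfKernel p K
      _ ≤ ∫⁻ y, (wasserstein p (κ y) (κ' y) ^ p + δ) ∂μ := by
        refine lintegral_mono_ae ?_
        filter_upwards [h, h'] with y h1 h2 using hKδ y h1 h2
      _ = _ := by rw [lintegral_add_right _ measurable_const]; simp
  · rintro _ ⟨γ, hγ, rfl⟩
    exact lintegral_wasserstein_le_cost hp0 hη hν hγ

end Joint

/-! ### The conditional Wasserstein distance -/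

set_option linter.unusedSectionVars false

section Conditional

variable {Y U : Type*}
  [NormedAddCommGroup Y] [InnerProductSpace ℝ Y] [CompleteSpace Y] [SecondCountableTopology Y]
  [MeasurableSpace Y] [BorelSpace Y]
  [NormedAddCommGroup U] [InnerProductSpace ℝ U] [CompleteSpace U] [SecondCountableTopology U]
  [MeasurableSpace U] [BorelSpace U]
  {μ : Measure Y} [IsProbabilityMeasure μ] {p : ℝ}
  {η ν : ProbabilityMeasure (WithLp 2 (Y × U))} {κ κ' : Kernel Y U}

lemma compProd_eq_of_isDisintegration (hη : η ∈ space U p μ)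
    (hκ : IsDisintegration κ (η : Measure (WithLp 2 (Y × U)))) :
    μ.compProd κ = (η : Measure (WithLp 2 (Y × U))).map WithLp.ofLp := by
  rw [← hκ.2, hη.2]

/-- The fibres inherit a finite moment since `‖u‖ ≤ ‖(y, u)‖`. -/
lemma ae_hasFiniteMoment (hp : 1 ≤ p) (hη : η ∈ space U p μ)
    (hκ : IsDisintegration κ (η : Measure (WithLp 2 (Y × U)))) :
    ∀ᵐ y ∂μ, HasFiniteMoment p (κ y) := by
  have := hκ.1
  have hm : Measurable fun y => ∫⁻ u, ‖u‖ₑ ^ p ∂(κ y) :=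
    Measurable.lintegral_kernel (f := fun u : U => ‖u‖ₑ ^ p) (by fun_prop)
  refine ae_lt_top hm (ne_top_of_le_ne_top hη.1.ne ?_)
  have : ∫⁻ y, ∫⁻ u, ‖u‖ₑ ^ p ∂(κ y) ∂μ = ∫⁻ q, ‖q.2‖ₑ ^ p ∂(μ.compProd κ) := by
    rw [Measure.lintegral_compProd (by fun_prop)]
  rw [this, compProd_eq_of_isDisintegration hη hκ,
    lintegral_map (by fun_prop) (WithLp.measurable_ofLp 2 (Y × U))]
  exact lintegral_mono fun z => ENNReal.rpow_le_rpow (WithLp.enorm_snd_le Y z) (by linarith)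

lemma condWasserstein_rpow (hp : 1 ≤ p) :
    condWasserstein p μ η ν ^ p =
      ∫⁻ y, wasserstein p (conditional (η : Measure (WithLp 2 (Y × U))) y)
        (conditional (ν : Measure (WithLp 2 (Y × U))) y) ^ p ∂μ := by
  rw [condWasserstein, meanWasserstein, ← ENNReal.rpow_mul,
    one_div_mul_cancel (by linarith), ENNReal.rpow_one]

lemma isLeast_condWasserstein (hp : 1 ≤ p) (hη : η ∈ space U p μ) (hν : ν ∈ space U p μ) :
    IsLeast (cost p '' triangularCouplings μ (η : Measure (WithLp 2 (Y × U)))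
      (ν : Measure (WithLp 2 (Y × U)))) (condWasserstein p μ η ν ^ p) := by
  have dη := isDisintegration_conditional (η : Measure (WithLp 2 (Y × U)))
  have dν := isDisintegration_conditional (ν : Measure (WithLp 2 (Y × U)))
  have := dη.1
  have := dν.1
  rw [condWasserstein_rpow hp]
  exact isLeast_cost_triangularCouplings hp (compProd_eq_of_isDisintegration hη dη)
    (compProd_eq_of_isDisintegration hν dν) (ae_hasFiniteMoment hp hη dη)
    (ae_hasFiniteMoment hp hν dν)

/-- An optimal triangular coupling, with the distance written as its `p`-th root cost. -/
lemma exists_triangular_cost_eq (hp : 1 ≤ p) (hη : η ∈ space U p μ) (hν : ν ∈ space U p μ) :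
    ∃ γ ∈ triangularCouplings μ (η : Measure (WithLp 2 (Y × U))) (ν : Measure (WithLp 2 (Y × U))),
      condWasserstein p μ η ν = cost p γ ^ (1 / p) := by
  obtain ⟨γ, hγ, h⟩ := (isLeast_condWasserstein hp hη hν).1
  refine ⟨γ, hγ, ?_⟩
  rw [h, ← ENNReal.rpow_mul, mul_one_div_cancel (by linarith), ENNReal.rpow_one]

lemma condWasserstein_lt_top (hp : 1 ≤ p) (hη : η ∈ space U p μ) (hν : ν ∈ space U p μ) :
    condWasserstein p μ η ν < ∞ := by
  obtain ⟨γ, hγ, h⟩ := exists_triangular_cost_eq hp hη hν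
  rw [h]
  refine ENNReal.rpow_lt_top_of_nonneg (by positivity)
    (ne_top_of_le_ne_top ?_ (cost_le_moments hp hγ.1))
  exact ENNReal.mul_ne_top (two_rpow_ne_top p hp) (ENNReal.add_ne_top.2 ⟨hη.1.ne, hν.1.ne⟩)

/-- Disintegrations are unique up to null sets, so the mean distance does not depend on them. -/
lemma meanWasserstein_eq (hη : η ∈ space U p μ) (hν : ν ∈ space U p μ)
    (hκ : IsDisintegration κ (η : Measure (WithLp 2 (Y × U))))
    (hκ' : IsDisintegration κ' (ν : Measure (WithLp 2 (Y × U)))) :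
    meanWasserstein p μ κ κ' = condWasserstein p μ η ν := by
  have dη := isDisintegration_conditional (η : Measure (WithLp 2 (Y × U)))
  have dν := isDisintegration_conditional (ν : Measure (WithLp 2 (Y × U)))
  have := dη.1
  have := dν.1
  have := hκ.1
  have := hκ'.1
  have e1 : κ =ᵐ[μ] conditional (η : Measure (WithLp 2 (Y × U))) := Kernel.ae_eq_of_compProd_eq <| by
    rw [compProd_eq_of_isDisintegration hη hκ, compProd_eq_of_isDisintegration hη dη]
  have e2 : κ' =ᵐ[μ] conditional (ν : Measure (WithLp 2 (Y × U))) :=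
    Kernel.ae_eq_of_compProd_eq <| by
      rw [compProd_eq_of_isDisintegration hν hκ', compProd_eq_of_isDisintegration hν dν]
  rw [condWasserstein, meanWasserstein, meanWasserstein]
  congr 1
  refine lintegral_congr_ae ?_
  filter_upwards [e1, e2] with y h1 h2
  rw [h1, h2]

lemma condWasserstein_self (hp : 1 ≤ p) (η : ProbabilityMeasure (WithLp 2 (Y × U))) :
    condWasserstein p μ η η = 0 := by
  have hp0 : 0 < p := by linarith
  simp [condWasserstein, meanWasserstein, wasserstein_self hp0, hp0]

lemma condWasserstein_comm (η ν : ProbabilityMeasure (WithLp 2 (Y × U))) :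
    condWasserstein p μ η ν = condWasserstein p μ ν η := by
  simp only [condWasserstein, meanWasserstein, wasserstein_comm p]

/-- The triangle inequality holds on each fibre and is integrated with Minkowski's inequality. -/
lemma condWasserstein_triangle (hp : 1 ≤ p) {η ν ξ : ProbabilityMeasure (WithLp 2 (Y × U))}
    (hη : η ∈ space U p μ) (hν : ν ∈ space U p μ) (hξ : ξ ∈ space U p μ) :
    condWasserstein p μ η ξ ≤ condWasserstein p μ η ν + condWasserstein p μ ν ξ := by
  have hp0 : 0 < p := by linarith
  have dη := isDisintegration_conditional (η : Measure (WithLp 2 (Y × U)))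
  have dν := isDisintegration_conditional (ν : Measure (WithLp 2 (Y × U)))
  have dξ := isDisintegration_conditional (ξ : Measure (WithLp 2 (Y × U)))
  have := dη.1
  have := dν.1
  have := dξ.1
  have root : ∀ {f : Y → ℝ≥0∞}, AEMeasurable (fun y => f y ^ p) μ → AEMeasurable f μ := by
    intro f hf
    have := hf.pow_const (1 / p)
    simpa only [← ENNReal.rpow_mul, mul_one_div_cancel hp0.ne', ENNReal.rpow_one] using this
  have m1 := root (aemeasurable_wasserstein_rpow hp _ _ (ae_hasFiniteMoment hp hη dη)
    (ae_hasFiniteMoment hp hν dν))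
  have m2 := root (aemeasurable_wasserstein_rpow hp _ _ (ae_hasFiniteMoment hp hν dν)
    (ae_hasFiniteMoment hp hξ dξ))
  refine le_trans (ENNReal.rpow_le_rpow (lintegral_mono fun y => ?_) (by positivity))
    (ENNReal.lintegral_Lp_add_le m1 m2 hp)
  exact ENNReal.rpow_le_rpow (wasserstein_triangle hp _ _ _) hp0.le

lemma eq_of_condWasserstein_eq_zero (hp : 1 ≤ p) (hη : η ∈ space U p μ) (hν : ν ∈ space U p μ)
    (h : condWasserstein p μ η ν = 0) : η = ν := by
  have hp0 : 0 < p := by linarith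
  obtain ⟨γ, hγ, h'⟩ := exists_triangular_cost_eq hp hη hν
  rw [h, eq_comm, ENNReal.rpow_eq_zero_iff_of_pos (by positivity)] at h'
  exact Subtype.ext (eq_of_cost_eq_zero hp0 hγ.1 h')

/-- The metric space structure given by the conditional Wasserstein distance. -/
@[reducible] def metricSpace (hp : 1 ≤ p) : MetricSpace (space U p μ) :=
  @EMetricSpace.toMetricSpace _
    { edist := fun η ν => condWasserstein p μ η.1 ν.1
      edist_self := fun η => condWasserstein_self hp η.1
      edist_comm := fun η ν => condWasserstein_comm η.1 ν.1
      edist_triangle := fun η ν ξ => condWasserstein_triangle hp η.2 ν.2 ξ.2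
      eq_of_edist_eq_zero := fun {η ν} h =>
        Subtype.ext (eq_of_condWasserstein_eq_zero hp η.2 ν.2 h) }
    fun η ν => (condWasserstein_lt_top hp η.2 ν.2).ne

lemma wasserstein_le_condWasserstein (hp : 1 ≤ p) (hη : η ∈ space U p μ) (hν : ν ∈ space U p μ) :
    wasserstein p (η : Measure (WithLp 2 (Y × U))) (ν : Measure (WithLp 2 (Y × U))) ≤
      condWasserstein p μ η ν := by
  obtain ⟨γ, hγ, h⟩ := exists_triangular_cost_eq hp hη hν
  exact (wasserstein_le_rpow_cost (by linarith) hγ.1).trans_eq h.symm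

lemma wasserstein_marginalU_le (hp : 1 ≤ p) (η ν : Measure (WithLp 2 (Y × U))) :
    wasserstein p (marginalU η) (marginalU ν) ≤ wasserstein p η ν := by
  refine ENNReal.rpow_le_rpow (le_iInf₂ fun γ hγ => ?_) (by positivity)
  have ms := measurable_withLp_snd (Y := Y) (U := U)
  refine (iInf₂_le _ (map_mem_couplings ms hγ)).trans ?_
  rw [cost, lintegral_map (measurable_edist_rpow p) (by fun_prop)]
  exact lintegral_mono fun z => ENNReal.rpow_le_rpow (WithLp.edist_snd_le z.1 z.2) (by linarith)

end Conditional

/-! ### Exchanging mass between two fibres -/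

lemma exists_measurableSet_of_ne_dirac {Y : Type*} [MeasurableSpace Y] [StandardBorelSpace Y]
    (μ : Measure Y) [IsProbabilityMeasure μ] (h : ∀ y, μ ≠ Measure.dirac y) :
    ∃ A, MeasurableSet A ∧ μ A ≠ 0 ∧ μ Aᶜ ≠ 0 := by
  by_contra! hA
  have : IsZeroOneMeasure μ := ⟨fun {s} hs => by
    by_cases h0 : μ s = 0
    · exact Or.inl h0
    · exact Or.inr ((prob_compl_eq_zero_iff hs).1 (hA s hs h0))⟩
  obtain ⟨y, hy⟩ := IsZeroOneMeasure.exists_eq_dirac (μ := μ)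
  exact h y hy

lemma edist_toLp_of_snd_eq {Y U : Type*} [PseudoEMetricSpace Y] [PseudoEMetricSpace U]
    (y y' : Y) (u : U) :
    edist (WithLp.toLp 2 (y, u)) (WithLp.toLp 2 (y', u)) = edist y y' := by
  rw [WithLp.prod_edist_eq_add (by norm_num)]
  simp only [WithLp.toLp_fst, WithLp.toLp_snd, edist_self, ENNReal.toReal_ofNat]
  rw [ENNReal.zero_rpow_of_pos (by norm_num), add_zero, ← ENNReal.rpow_mul]
  norm_num

lemma enorm_withLp_le {Y U : Type*} [NormedAddCommGroup Y] [NormedAddCommGroup U]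
    (z : WithLp 2 (Y × U)) : ‖z‖ₑ ≤ ‖z.fst‖ₑ + ‖z.snd‖ₑ := by
  have hz : z = WithLp.toLp 2 (z.fst, 0) + WithLp.toLp 2 (0, z.snd) := by
    apply (WithLp.equiv 2 (Y × U)).injective
    ext <;> simp
  calc ‖z‖ₑ ≤ ‖WithLp.toLp 2 (z.fst, (0 : U))‖ₑ + ‖WithLp.toLp 2 ((0 : Y), z.snd)‖ₑ := by
        conv_lhs => rw [hz]
        exact enorm_add_le _ _
    _ = _ := by simp [enorm_eq_nnnorm]

section Exchange

variable {Y U : Type*} [MeasurableSpace Y] [MeasurableSpace U]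

/-- The law on `Y × U` with `Y`-marginal `μ` whose fibres are `μ Aᶜ • δ_v + μ A • δ_0` over `A`
and `δ_0` over `Aᶜ`. The laws for `A` and for `Aᶜ` put the same mass at height `v`. -/
def raised [Zero U] (μ : Measure Y) (A : Set Y) (v : U) : Measure (WithLp 2 (Y × U)) :=
  (μ Aᶜ • μ.restrict A).map (fun y => WithLp.toLp 2 (y, v)) +
    (μ A • μ.restrict A + μ.restrict Aᶜ).map (fun y => WithLp.toLp 2 (y, 0))

/-- The coupling of `raised μ A v` and `raised μ Aᶜ v` which keeps the common part at height `0`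
and otherwise moves mass between `A` and `Aᶜ` at constant height. -/
def exchange [Zero U] (μ : Measure Y) (A : Set Y) (v : U) :
    Measure (WithLp 2 (Y × U) × WithLp 2 (Y × U)) :=
  ((μ.restrict A).prod (μ.restrict Aᶜ)).map
      (fun q => (WithLp.toLp 2 (q.1, v), WithLp.toLp 2 (q.2, v))) +
    ((μ A • μ.restrict A + μ Aᶜ • μ.restrict Aᶜ).map
      (fun y => (WithLp.toLp 2 (y, 0), WithLp.toLp 2 (y, 0))) +
    ((μ.restrict Aᶜ).prod (μ.restrict A)).map
      (fun q => (WithLp.toLp 2 (q.1, 0), WithLp.toLp 2 (q.2, 0))))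

variable {μ : Measure Y} [IsProbabilityMeasure μ] {A : Set Y}

lemma smul_add_smul_restrict (hA : MeasurableSet A) (m : Measure Y) : μ A • m + μ Aᶜ • m = m := by
  rw [← add_smul, prob_add_prob_compl hA, one_smul]

lemma map_fst_raised [Zero U] (hA : MeasurableSet A) (v : U) :
    (raised μ A v).map WithLp.fst = μ := by
  have mf := measurable_withLp_fst (Y := Y) (U := U)
  have hi : ∀ u : U, Measurable fun y : Y => WithLp.toLp 2 (y, u) := fun u => by fun_prop
  have hid : ∀ u : U, (WithLp.fst ∘ fun y : Y => WithLp.toLp 2 (y, u)) = id := fun u => rfl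
  rw [raised, Measure.map_add _ _ mf, Measure.map_map mf (hi _), Measure.map_map mf (hi _), hid,
    hid, Measure.map_id, Measure.map_id, ← add_assoc, add_comm (μ Aᶜ • _),
    smul_add_smul_restrict hA, Measure.restrict_add_restrict_compl hA]

lemma exchange_mem_couplings [Zero U] (hA : MeasurableSet A) (v : U) :
    exchange μ A v ∈ couplings (raised μ A v) (raised μ Aᶜ v) := by
  have hi : ∀ u : U, Measurable fun y : Y => WithLp.toLp 2 (y, u) := fun u => by fun_prop
  have hp : ∀ u : U, Measurable fun q : Y × Y =>
      ((WithLp.toLp 2 (q.1, u), WithLp.toLp 2 (q.2, u)) :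
        WithLp 2 (Y × U) × WithLp 2 (Y × U)) := fun u => by fun_prop
  have hd : Measurable fun y : Y =>
      ((WithLp.toLp 2 (y, (0 : U)), WithLp.toLp 2 (y, (0 : U))) :
        WithLp 2 (Y × U) × WithLp 2 (Y × U)) := by fun_prop
  have f1 : ∀ (m m' : Measure Y) [SFinite m] [SFinite m'] (u : U), ((m.prod m').map fun q =>
      ((WithLp.toLp 2 (q.1, u), WithLp.toLp 2 (q.2, u)) :
        WithLp 2 (Y × U) × WithLp 2 (Y × U))).map Prod.fst =
      (m' Set.univ • m).map fun y => WithLp.toLp 2 (y, u) := by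
    intro m m' _ _ u
    rw [Measure.map_map measurable_fst (hp u), ← Measure.map_fst_prod,
      Measure.map_map (hi u) measurable_fst]
    rfl
  have f2 : ∀ (m m' : Measure Y) [SFinite m] [SFinite m'] (u : U), ((m.prod m').map fun q =>
      ((WithLp.toLp 2 (q.1, u), WithLp.toLp 2 (q.2, u)) :
        WithLp 2 (Y × U) × WithLp 2 (Y × U))).map Prod.snd =
      (m Set.univ • m').map fun y => WithLp.toLp 2 (y, u) := by
    intro m m' _ _ u
    rw [Measure.map_map measurable_snd (hp u), ← Measure.map_snd_prod,
      Measure.map_map (hi u) measurable_snd]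
    rfl
  refine ⟨?_, ?_⟩
  · rw [exchange, Measure.map_add _ _ measurable_fst, Measure.map_add _ _ measurable_fst, f1, f1,
      Measure.map_map measurable_fst hd, Measure.restrict_apply_univ, Measure.restrict_apply_univ,
      raised]
    congr 1
    rw [show (Prod.fst ∘ fun y : Y => ((WithLp.toLp 2 (y, (0 : U)), WithLp.toLp 2 (y, (0 : U))) :
      WithLp 2 (Y × U) × WithLp 2 (Y × U))) = fun y => WithLp.toLp 2 (y, (0 : U)) from rfl,
      ← Measure.map_add _ _ (hi 0), add_assoc, add_comm (μ Aᶜ • μ.restrict Aᶜ),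
      smul_add_smul_restrict hA]
  · rw [exchange, Measure.map_add _ _ measurable_snd, Measure.map_add _ _ measurable_snd, f2, f2,
      Measure.map_map measurable_snd hd, Measure.restrict_apply_univ, Measure.restrict_apply_univ,
      raised, compl_compl]
    congr 1
    rw [show (Prod.snd ∘ fun y : Y => ((WithLp.toLp 2 (y, (0 : U)), WithLp.toLp 2 (y, (0 : U))) :
      WithLp 2 (Y × U) × WithLp 2 (Y × U))) = fun y => WithLp.toLp 2 (y, (0 : U)) from rfl,
      ← Measure.map_add _ _ (hi 0), add_right_comm, smul_add_smul_restrict hA, add_comm]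

end Exchange

section NotDominated

variable {Y U : Type*}
  [NormedAddCommGroup Y] [InnerProductSpace ℝ Y] [CompleteSpace Y] [SecondCountableTopology Y]
  [MeasurableSpace Y] [BorelSpace Y]
  [NormedAddCommGroup U] [InnerProductSpace ℝ U] [CompleteSpace U] [SecondCountableTopology U]
  [MeasurableSpace U] [BorelSpace U]
  {μ : Measure Y} [IsProbabilityMeasure μ] {p : ℝ} {A : Set Y}

lemma isProbabilityMeasure_raised (hA : MeasurableSet A) (v : U) :
    IsProbabilityMeasure (raised μ A v) := by
  have : IsProbabilityMeasure ((raised μ A v).map WithLp.fst) := by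
    rw [map_fst_raised hA]; infer_instance
  exact Measure.isProbabilityMeasure_of_map (WithLp.fst : WithLp 2 (Y × U) → Y)

lemma ae_enorm_snd_raised_le (v : U) : ∀ᵐ z ∂(raised μ A v), ‖z.snd‖ₑ ≤ ‖v‖ₑ := by
  have ms := measurable_withLp_snd (Y := Y) (U := U)
  have hset : MeasurableSet {z : WithLp 2 (Y × U) | ‖z.snd‖ₑ ≤ ‖v‖ₑ} :=
    measurableSet_le (by fun_prop) measurable_const
  rw [raised, ae_add_measure_iff]
  constructor
  · rw [ae_map_iff (by fun_prop) hset]; simp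
  · rw [ae_map_iff (by fun_prop) hset]; simp

lemma hasFiniteMoment_raised (hp : 1 ≤ p) (hμ : HasFiniteMoment p μ) (hA : MeasurableSet A)
    (v : U) : HasFiniteMoment p (raised μ A v) := by
  have hp0 : 0 ≤ p := by linarith
  have := isProbabilityMeasure_raised (μ := μ) hA v
  have mf := measurable_withLp_fst (Y := Y) (U := U)
  have hY : ∫⁻ z, ‖z.fst‖ₑ ^ p ∂(raised μ A v) = ∫⁻ y, ‖y‖ₑ ^ p ∂μ := by
    conv_rhs => rw [← map_fst_raised (μ := μ) hA v]
    rw [lintegral_map (by fun_prop) mf]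
  have hle : ∫⁻ z, ‖z‖ₑ ^ p ∂(raised μ A v) ≤
      ∫⁻ z, 2 ^ (p - 1) * (‖z.fst‖ₑ ^ p + ‖v‖ₑ ^ p) ∂(raised μ A v) := by
    refine lintegral_mono_ae ?_
    filter_upwards [ae_enorm_snd_raised_le v] with z hz
    refine (ENNReal.rpow_le_rpow ((enorm_withLp_le z).trans (add_le_add le_rfl hz)) hp0).trans ?_
    exact ENNReal.rpow_add_le_mul_rpow_add_rpow _ _ hp
  refine hle.trans_lt ?_
  rw [lintegral_const_mul _ (by fun_prop), lintegral_add_left (by fun_prop), hY]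
  simp only [lintegral_const, measure_univ, mul_one]
  refine ENNReal.mul_lt_top (two_rpow_ne_top p hp).lt_top (ENNReal.add_lt_top.2 ⟨hμ, ?_⟩)
  exact ENNReal.rpow_lt_top_of_nonneg hp0 enorm_ne_top

lemma raised_mem_space (hp : 1 ≤ p) (hμ : HasFiniteMoment p μ) (hA : MeasurableSet A) (v : U) :
    (⟨raised μ A v, isProbabilityMeasure_raised hA v⟩ : ProbabilityMeasure (WithLp 2 (Y × U))) ∈
      space U p μ :=
  ⟨hasFiniteMoment_raised hp hμ hA v, map_fst_raised hA v⟩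

/-- The cost of the exchange coupling does not depend on the height. -/
lemma cost_exchange (hp : 0 < p) (v : U) :
    cost p (exchange μ A v) = cost p ((μ.restrict A).prod (μ.restrict Aᶜ)) +
      cost p ((μ.restrict Aᶜ).prod (μ.restrict A)) := by
  have h0 : ∀ m : Measure Y, ∫⁻ z, edist z.1 z.2 ^ p ∂(m.map fun y =>
      ((WithLp.toLp 2 (y, (0 : U)), WithLp.toLp 2 (y, (0 : U))) :
        WithLp 2 (Y × U) × WithLp 2 (Y × U))) = 0 := by
    intro m
    rw [lintegral_map (measurable_edist_rpow p) (by fun_prop)]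
    simp [hp]
  rw [cost, exchange, lintegral_add_measure, lintegral_add_measure, h0, zero_add,
    lintegral_map (measurable_edist_rpow p) (by fun_prop),
    lintegral_map (measurable_edist_rpow p) (by fun_prop)]
  simp only [edist_toLp_of_snd_eq]
  rfl

lemma cost_prod_restrict_ne_top (hp : 1 ≤ p) (hμ : HasFiniteMoment p μ) (A B : Set Y) :
    cost p ((μ.restrict A).prod (μ.restrict B)) ≠ ∞ := by
  have hm : ((μ.restrict A).prod (μ.restrict B)) ∈
      couplings (μ B • μ.restrict A) (μ A • μ.restrict B) := by
    constructor
    · rw [Measure.map_fst_prod, Measure.restrict_apply_univ]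
    · rw [Measure.map_snd_prod, Measure.restrict_apply_univ]
  have hb : ∀ S T : Set Y, ∫⁻ y, ‖y‖ₑ ^ p ∂(μ S • μ.restrict T) ≠ ∞ := by
    intro S T
    rw [lintegral_smul_measure]
    exact ENNReal.mul_ne_top (measure_ne_top _ _)
      (ne_top_of_le_ne_top hμ.ne (setLIntegral_le_lintegral _ _))
  exact ne_top_of_le_ne_top (ENNReal.mul_ne_top (two_rpow_ne_top p hp)
    (ENNReal.add_ne_top.2 ⟨hb _ _, hb _ _⟩)) (cost_le_moments hp hm)

/-- A triangular coupling has to bring the mass raised over `A` down to height `0`. -/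
lemma le_cost_of_triangular (hp : 0 < p) (hA : MeasurableSet A) (v : U)
    {γ : Measure (WithLp 2 (Y × U) × WithLp 2 (Y × U))}
    (hγ : γ ∈ triangularCouplings μ (raised μ A v) (raised μ Aᶜ v)) :
    ‖v‖ₑ ^ p * (μ Aᶜ * μ A) ≤ cost p γ := by
  have mf := measurable_withLp_fst (Y := Y) (U := U)
  have ms := measurable_withLp_snd (Y := Y) (U := U)
  have hae := ae_fst_eq_of_triangular hγ
  let S : Set (WithLp 2 (Y × U)) := {z | z.fst ∈ A ∧ z.snd = v}
  have hS : MeasurableSet S := (mf hA).inter (ms (measurableSet_singleton v))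
  have hmass : μ Aᶜ * μ A ≤ γ (Prod.fst ⁻¹' S) := by
    rw [← Measure.map_apply measurable_fst hS, hγ.1.1, raised, Measure.add_apply]
    refine le_trans (le_of_eq ?_) le_self_add
    rw [Measure.map_apply (by fun_prop) hS]
    have : (fun y : Y => WithLp.toLp 2 (y, v)) ⁻¹' S = A := by ext y; simp [S]
    rw [this, Measure.smul_apply, Measure.restrict_apply_self, smul_eq_mul]
  have hzero : ∀ᵐ z ∂γ, z.2.fst ∈ A → z.2.snd = 0 := by
    have hB : MeasurableSet {z : WithLp 2 (Y × U) | z.fst ∈ A → z.snd = 0} := by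
      have : {z : WithLp 2 (Y × U) | z.fst ∈ A → z.snd = 0} =
          (WithLp.fst ⁻¹' A)ᶜ ∪ WithLp.snd ⁻¹' {0} := by
        ext z; simp [imp_iff_not_or]
      rw [this]
      exact (mf hA).compl.union (ms (measurableSet_singleton 0))
    have : ∀ᵐ z ∂(γ.map Prod.snd), z.fst ∈ A → z.snd = 0 := by
      rw [hγ.1.2, raised, ae_add_measure_iff]
      constructor
      · rw [ae_map_iff (by fun_prop) hB]
        refine Measure.ae_smul_measure ?_ _
        filter_upwards [ae_restrict_mem hA.compl] with y hy hy' using absurd hy' hy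
      · rw [ae_map_iff (by fun_prop) hB]; simp
    exact ae_of_ae_map measurable_snd.aemeasurable this
  calc ‖v‖ₑ ^ p * (μ Aᶜ * μ A) ≤ ‖v‖ₑ ^ p * γ (Prod.fst ⁻¹' S) := by gcongr
    _ = ∫⁻ _ in Prod.fst ⁻¹' S, ‖v‖ₑ ^ p ∂γ := by rw [setLIntegral_const]
    _ ≤ ∫⁻ z in Prod.fst ⁻¹' S, edist z.1 z.2 ^ p ∂γ := by
      refine setLIntegral_mono_ae' (measurable_fst hS) ?_
      filter_upwards [hae, hzero] with z h1 h2 hz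
      have h3 : z.1.fst ∈ A := hz.1
      have h4 : z.1.snd = v := hz.2
      refine ENNReal.rpow_le_rpow ?_ hp.le
      have := WithLp.edist_snd_le z.1 z.2
      rwa [h4, h2 (h1 ▸ h3), edist_zero_right] at this
    _ ≤ cost p γ := setLIntegral_le_lintegral _ _

/-- Raising the height separates the conditional distance from the usual one. -/
theorem not_exists_condWasserstein_le [Nontrivial U] (hp : 1 ≤ p) (hμ : HasFiniteMoment p μ)
    (hd : ∀ y : Y, μ ≠ Measure.dirac y) :
    ¬ ∃ C : ℝ≥0, ∀ η ∈ space U p μ, ∀ ν ∈ space U p μ, condWasserstein p μ η ν ≤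
      C * wasserstein p (η : Measure (WithLp 2 (Y × U))) (ν : Measure (WithLp 2 (Y × U))) := by
  rintro ⟨C, hC⟩
  have hp0 : 0 < p := by linarith
  obtain ⟨A, hA, h1, h2⟩ := exists_measurableSet_of_ne_dirac μ hd
  set B := cost p ((μ.restrict A).prod (μ.restrict Aᶜ)) +
    cost p ((μ.restrict Aᶜ).prod (μ.restrict A)) with hB
  have hBtop : B ≠ ∞ := ENNReal.add_ne_top.2
    ⟨cost_prod_restrict_ne_top hp hμ _ _, cost_prod_restrict_ne_top hp hμ _ _⟩
  set s := (μ Aᶜ * μ A) ^ (1 / p) with hs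
  have hs0 : s ≠ 0 := by
    rw [hs, Ne, ENNReal.rpow_eq_zero_iff_of_pos (by positivity)]; exact mul_ne_zero h2 h1
  have hs_fin : s ≠ ∞ := ENNReal.rpow_ne_top_of_nonneg (by positivity) (by finiteness)
  have key : ∀ v : U, ‖v‖ₑ * s ≤ C * B ^ (1 / p) := by
    intro v
    have m1 := raised_mem_space (U := U) hp hμ hA v
    have m2 := raised_mem_space (U := U) hp hμ hA.compl v
    obtain ⟨γ, hγ, he⟩ := exists_triangular_cost_eq hp m1 m2
    calc ‖v‖ₑ * s = (‖v‖ₑ ^ p * (μ Aᶜ * μ A)) ^ (1 / p) := by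
          rw [ENNReal.mul_rpow_of_nonneg _ _ (by positivity), ← ENNReal.rpow_mul,
            mul_one_div_cancel hp0.ne', ENNReal.rpow_one]
      _ ≤ cost p γ ^ (1 / p) :=
          ENNReal.rpow_le_rpow (le_cost_of_triangular hp0 hA v hγ) (by positivity)
      _ ≤ C * wasserstein p (raised μ A v) (raised μ Aᶜ v) := he ▸ hC _ m1 _ m2
      _ ≤ C * B ^ (1 / p) := by
          rw [hB, ← cost_exchange (U := U) hp0 v]
          gcongr
          exact wasserstein_le_rpow_cost hp0 (exchange_mem_couplings hA v)
  have hfin : C * B ^ (1 / p) / s ≠ ∞ := ENNReal.div_ne_top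
    (ENNReal.mul_ne_top (by simp) (ENNReal.rpow_ne_top_of_nonneg (by positivity) hBtop)) hs0
  obtain ⟨v, hv⟩ := NormedSpace.exists_lt_norm ℝ U (C * B ^ (1 / p) / s).toReal
  have hv' : C * B ^ (1 / p) / s < ‖v‖ₑ := by
    rw [← ofReal_norm, ENNReal.lt_ofReal_iff_toReal_lt hfin]; exact hv
  exact absurd (ENNReal.le_div_iff_mul_le (Or.inl hs0) (Or.inl hs_fin) |>.2 (key v)) hv'.not_ge

end NotDominated

end CondWasserstein

end

theorem mainTheorem5
    {Y U : Type*}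
    [NormedAddCommGroup Y] [InnerProductSpace ℝ Y] [CompleteSpace Y] [SecondCountableTopology Y]
    [MeasurableSpace Y] [BorelSpace Y]
    [NormedAddCommGroup U] [InnerProductSpace ℝ U] [CompleteSpace U] [SecondCountableTopology U]
    [MeasurableSpace U] [BorelSpace U]
    (μ : Measure Y) [IsProbabilityMeasure μ] (p : ℝ) (hp : 1 ≤ p) :
    -- (a) well-defined, finite, and equal to the minimal conditional Kantorovich cost
    (∀ η ∈ CondWasserstein.space U p μ, ∀ ν ∈ CondWasserstein.space U p μ,
      (∀ κ κ' : Kernel Y U,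
        CondWasserstein.IsDisintegration κ (η : Measure (WithLp 2 (Y × U))) →
        CondWasserstein.IsDisintegration κ' (ν : Measure (WithLp 2 (Y × U))) →
          (∀ᵐ y ∂μ, CondWasserstein.HasFiniteMoment p (κ y) ∧
            CondWasserstein.HasFiniteMoment p (κ' y) ∧
            CondWasserstein.wasserstein p (κ y) (κ' y) < ∞) ∧
          AEMeasurable (fun y => CondWasserstein.wasserstein p (κ y) (κ' y) ^ p) μ ∧
          CondWasserstein.meanWasserstein p μ κ κ' =
            CondWasserstein.condWasserstein p μ η ν) ∧
      CondWasserstein.condWasserstein p μ η ν < ∞ ∧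
      IsLeast
        (CondWasserstein.cost p ''
          CondWasserstein.triangularCouplings μ (η : Measure (WithLp 2 (Y × U)))
            (ν : Measure (WithLp 2 (Y × U))))
        (CondWasserstein.condWasserstein p μ η ν ^ p)) ∧
    -- (b) a metric
    (∃ _ : MetricSpace (CondWasserstein.space U p μ),
      ∀ η ν : CondWasserstein.space U p μ,
        edist η ν = CondWasserstein.condWasserstein p μ η.1 ν.1) ∧
    -- (c) not dominated by a multiple of the usual distance
    (Nontrivial U → CondWasserstein.HasFiniteMoment p μ → (∀ y : Y, μ ≠ Measure.dirac y) →
      ¬ ∃ C : ℝ≥0, ∀ η ∈ CondWasserstein.space U p μ, ∀ ν ∈ CondWasserstein.space U p μ,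
        CondWasserstein.condWasserstein p μ η ν ≤
          C * CondWasserstein.wasserstein p (η : Measure (WithLp 2 (Y × U)))
            (ν : Measure (WithLp 2 (Y × U)))) ∧
    -- (d) comparison with the usual distances
    (∀ η ∈ CondWasserstein.space U p μ, ∀ ν ∈ CondWasserstein.space U p μ,
      CondWasserstein.wasserstein p
          (CondWasserstein.marginalU (η : Measure (WithLp 2 (Y × U))))
          (CondWasserstein.marginalU (ν : Measure (WithLp 2 (Y × U)))) ≤
        CondWasserstein.condWasserstein p μ η ν ∧
      CondWasserstein.wasserstein p (η : Measure (WithLp 2 (Y × U)))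
          (ν : Measure (WithLp 2 (Y × U))) ≤
        CondWasserstein.condWasserstein p μ η ν) := by
  refine ⟨fun η hη ν hν => ⟨fun κ κ' hκ hκ' => ?_, CondWasserstein.condWasserstein_lt_top hp hη hν,
    CondWasserstein.isLeast_condWasserstein hp hη hν⟩,
    ⟨CondWasserstein.metricSpace hp, fun _ _ => rfl⟩, ?_,
    fun η hη ν hν => ⟨(CondWasserstein.wasserstein_marginalU_le hp _ _).trans ?_, ?_⟩⟩
  · have := hκ.1
    have := hκ'.1
    have h1 := CondWasserstein.ae_hasFiniteMoment hp hη hκ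
    have h2 := CondWasserstein.ae_hasFiniteMoment hp hν hκ'
    refine ⟨?_, CondWasserstein.aemeasurable_wasserstein_rpow hp κ κ' h1 h2,
      CondWasserstein.meanWasserstein_eq hη hν hκ hκ'⟩
    filter_upwards [h1, h2] with y hy hy' using
      ⟨hy, hy', CondWasserstein.wasserstein_lt_top hp hy hy'⟩
  · intro _ hμ hd
    exact CondWasserstein.not_exists_condWasserstein_le hp hμ hd
  · exact CondWasserstein.wasserstein_le_condWasserstein hp hη hν
  · exact CondWasserstein.wasserstein_le_condWasserstein hp hη hν
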